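/- **Setting.** Let $d\ge 2$ and let $M$ be a branched triangulation of a closed $d$-manifold, orientable or not. (More generally: $M$ is a finite pure $d$-dimensional simplicial complex in which every $(d-1)$-simplex lies in exactly two $d$-simplices, with a branching structure, i.e. an orientation of the edges without oriented cycles on 2-simplices.) The branching orders the vertices of each $d$-simplex as $0,\dots,d$; write $\hat\imath$ for the facet opposite to vertex $i$ and also for the dual half-edge from the centre of the $d$-simplex to it. Choose a label $\pm$ for each $d$-simplex. Let $w_1$ be the set of $(d-1)$-simplices on which the orientations induced by the two adjacent $d$-simplices (branching orientation times label) do not cancel. For each $(d-1)$-simplex in $w_1$ choose a direction across it (the direction of the background orientation vector in $\det TM$ as it crosses the wall). **Windings.** Let a path run through a $d$-simplex of label $s=\pm1$ from $\hat\imath$ to $\hat\jmath$, and let $\tau$ go from $0$ to $1$ near the centre. Vectors in $\mathbb R^{d+1}$ are taken modulo $b_0=(1,\dots,1)$, and $b_k=(1,2^{-k},\dots,(d+1)^{-k})$; near the facet $\hat\imath$ (resp. $\hat\jmath$) the $i$-th (resp. $j$-th) component of $b_k$, $k\ge1$, is continuously projected out. The background framing is $b_1,\dots,b_{d-1}$ followed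 by $\frac{s}{d}(-1)^{d+\binom d2}\big((1-\tau)(-1)^i e_i+\tau(-1)^j e_j\big)$. The tangent framing is $b_1,\dots,b_{d-2}$ followed by $\frac{s\varepsilon}{d}(-1)^{i+j+\binom{d-1}2+\delta_{i>j}}\big(\tau e_i+(1-\tau)e_j\big)$ and by the tangent vector $\frac1d\big((1-\tau)e_i-\tau e_j\big)$, where $\varepsilon=\pm1$ according to whether the orientation vectors of the two framings agree or disagree. Let $\theta_\varepsilon$ be the total angle by which the last background vector, modulo the shared vectors $b_1,\dots,b_{d-2}$, turns in the plane of the last two tangent vectors; the sense of rotation in this plane is that of the ordered pair (last, second last) multiplied by $(-1)^{\binom{d-1}{2}}$. With Pauli matrices $X,Y$, the winding matrix of the path is $\mathrm{diag}(e^{i\theta_{+}X/2},e^{i\theta_{-}X/2})$, and the winding matrix of a crossing of $w_1$ is $\pm\begin{pmatrix}0&iY\\-iY&0\end{pmatrix}$, with sign $+$ if the path runs in the chosen direction and $-$ otherwise. These act on pairs $(\mathcal O_{\rm same},\mathcal O_{\rm opposite})$ of $2\times2$ matrices. **Loops.** Resolve the $(d+1)$-valent vertex of the dual 1-skeleton at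 the centre of each $d$-simplex by a planar trivalent tree whose legs occur in the cyclic order $\hat0,\hat2,\hat4,\dots,\hat1,\hat3,\hat5,\dots$ (even legs up and increasing from left to right, odd legs down and decreasing from left to right); any such tree is allowed at any simplex. For a cocycle $\alpha\in Z^{d-1}(M,\mathbb Z_2)$, the edges dual to the $(d-1)$-simplices with $\alpha=1$ then decompose into disjoint loops. For a loop $C$ with winding matrices $W_1,\dots,W_k$ in order, let $\varphi(C)$ be the upper left entry of $\mathcal O_{\rm same}+\mathcal O_{\rm opposite}$, where $(\mathcal O_{\rm same},\mathcal O_{\rm opposite})=W_k\cdots W_1(\mathbb 1,0)$; that is, $\varphi(C)=i^{\text{number of right half-twists}}$. Define $$\sigma(M,\alpha)=(-1)^{\#\text{loops}}\prod_{\text{loops }C}\varphi(C).$$ **Theorem.** For every cocycle $\alpha\in Z^{d-1}(M,\mathbb Z_2)$ and every loop $C$ of $\alpha$, the factor $\varphi(C)$ does not depend on the starting point or the direction of traversal, so $\sigma(M,\alpha)$ is well defined; and for all cocycles $\beta,\beta'\in Z^{d-1}(M,\mathbb Z_2)$, $$\sigma(M,\beta)\,\sigma(M,\beta')=(-1)^{\int_M\beta\cup_{d-2}\beta'}\,\sigma(M,\beta+\beta'),$$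 where $\cup_{d-2}$ is Steenrod's higher cup product on cochains and $\int_M$ is the sum over all $d$-simplices. -/

import Mathlib

/-! Branched triangulations of closed manifolds, cochains and higher cup products, the background and
tangent framings along the dual 1-skeleton, and the loop weight `σ`. -/

noncomputable section

open scoped Classical

namespace LoopWeight

/-! ### Branched triangulations and mod 2 cochains -/

/-- A finite pure `d`-dimensional simplicial complex in which every `(d-1)`-simplex lies in exactly
two `d`-simplices (so every triangulation of a closed `d`-manifold is an instance; neither
orientability nor connectedness is required), with a branching structure: an orientation of the edges
without an oriented cycle on any 2-simplex. -/
structure BranchedTriangulation (V : Type*) (d : ℕ) extends PreAbstractSimplicialComplex V where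
  finite_faces : faces.Finite
  pure_dim : ∀ s ∈ faces, ∃ t ∈ faces, s ⊆ t ∧ t.card = d + 1
  two_sided : ∀ t ∈ faces, t.card = d → {s ∈ faces | s.card = d + 1 ∧ t ⊆ s}.ncard = 2
  /-- `arrow u v`: the edge `{u, v}` points from `u` to `v`. -/
  arrow : V → V → Prop
  arrow_iff : ∀ u v, u ≠ v → {u, v} ∈ faces → (arrow u v ↔ ¬ arrow v u)
  acyclic : ∀ u v w, u ≠ v → v ≠ w → u ≠ w → {u, v, w} ∈ faces →
    ¬ (arrow u v ∧ arrow v w ∧ arrow w u)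

variable {V : Type*} {d : ℕ}

namespace BranchedTriangulation

/-- The set of `p`-simplices. -/
def simplices (M : BranchedTriangulation V d) (p : ℕ) : Set (Finset V) :=
  {s ∈ M.faces | s.card = p + 1}

/-- The position `i ∈ {0, …, p}` of the vertex `v` of a `p`-simplex `s` in the vertex order that the
branching structure induces on `s`. -/
def pos (M : BranchedTriangulation V d) (s : Finset V) (v : V) : ℕ :=
  (s.filter fun u => u ≠ v ∧ M.arrow u v).card

/-- `C^p(M, ℤ/2)`. -/
abbrev Cochain (M : BranchedTriangulation V d) (p : ℕ) : Type _ := M.simplices p → ZMod 2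

/-- The value of a `p`-cochain on a set of vertices, read as `0` if the set is not a `p`-simplex. -/
def ev (M : BranchedTriangulation V d) {p : ℕ} (α : M.Cochain p) (t : Finset V) : ZMod 2 :=
  if h : t ∈ M.simplices p then α ⟨t, h⟩ else 0

/-- The coboundary `δ`. -/
def coboundary (M : BranchedTriangulation V d) {p : ℕ} (α : M.Cochain p) : M.Cochain (p + 1) :=
  fun s => ∑ v ∈ s.1, M.ev α (s.1.erase v)

def IsCocycle (M : BranchedTriangulation V d) {p : ℕ} (α : M.Cochain p) : Prop :=
  M.coboundary α = 0

/-- Given `J = {j₀ < ⋯ < j_i}` in the simplex `s`, the union of the even-numbered ones among the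
closed intervals `0 → j₀`, `j₀ → j₁`, …, `j_i → n` into which `J` cuts `s`. -/
def evenBlocks (M : BranchedTriangulation V d) (s J : Finset V) : Finset V :=
  s.filter fun v => v ∈ J ∨ Even (J.filter fun j => M.pos s j < M.pos s v).card

/-- The union of the odd-numbered intervals. -/
def oddBlocks (M : BranchedTriangulation V d) (s J : Finset V) : Finset V :=
  s.filter fun v => v ∈ J ∨ Odd (J.filter fun j => M.pos s j < M.pos s v).card

/-- Steenrod's `α ∪_i β`, an `n`-cochain for `n = p + q - i`:
`∑_{j₀ < ⋯ < j_i} α(0 → j₀, j₁ → j₂, …) β(j₀ → j₁, j₂ → j₃, …)`, the sum being over the `j`'s for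
which the two arguments are a `p`-simplex and a `q`-simplex (`ev` vanishes on the other sets). -/
def cup (M : BranchedTriangulation V d) (i : ℕ) {p q : ℕ} (α : M.Cochain p) (β : M.Cochain q)
    (n : ℕ) : M.Cochain n :=
  fun s => ∑ J ∈ s.1.powersetCard (i + 1), M.ev α (M.evenBlocks s.1 J) * M.ev β (M.oddBlocks s.1 J)

/-- `∫_M γ`: the sum over all `d`-simplices. -/
def integral (M : BranchedTriangulation V d) (γ : M.Cochain d) : ZMod 2 := ∑ᶠ s, γ s

/-! ### Half-edges of the dual 1-skeleton -/

/-- A half-edge of the dual 1-skeleton: the segment inside a `d`-simplex from its centre to the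
facet opposite to one of its vertices. -/
@[ext]
structure HalfEdge (M : BranchedTriangulation V d) where
  simplex : Finset V
  opp : V
  simplex_mem : simplex ∈ M.simplices d
  opp_mem : opp ∈ simplex

/-- The `(d-1)`-simplex dual to the edge. -/
def facet (M : BranchedTriangulation V d) (h : M.HalfEdge) : Finset V := h.simplex.erase h.opp

/-- The label `i` of the half-edge `î`. -/
def index (M : BranchedTriangulation V d) (h : M.HalfEdge) : ℕ := M.pos h.simplex h.opp

theorem existsUnique_glue (M : BranchedTriangulation V d) (hd : 1 ≤ d) (h : M.HalfEdge) :
    ∃! h' : M.HalfEdge, h' ≠ h ∧ M.facet h' = M.facet h := by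
  obtain ⟨s, v, ⟨hs, hc⟩, hv⟩ := h
  have hcard : (s.erase v).card = d := by rw [Finset.card_erase_of_mem hv, hc]; rfl
  have hf : s.erase v ∈ M.faces :=
    (M.isRelLowerSet_faces hs).2 (Finset.erase_subset v s)
      (Finset.card_pos.mp (by omega))
  obtain ⟨a, b, hab, hset⟩ := Set.ncard_eq_two.mp (M.two_sided _ hf hcard)
  have hmem : s ∈ ({a, b} : Set (Finset V)) := by
    rw [← hset]; exact ⟨hs, hc, Finset.erase_subset v s⟩
  have key : ∃ t, t ≠ s ∧ ∀ u, (u ∈ M.faces ∧ u.card = d + 1 ∧ s.erase v ⊆ u) ↔ u = s ∨ u = t := by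
    rcases hmem with rfl | hm
    · exact ⟨b, hab.symm, fun u => Set.ext_iff.mp hset u⟩
    · have hm : s = b := hm
      subst hm
      exact ⟨a, hab, fun u => (Set.ext_iff.mp hset u).trans or_comm⟩
  obtain ⟨t, hts, ht⟩ := key
  obtain ⟨htf, htc, hsub⟩ := (ht t).mpr (Or.inr rfl)
  obtain ⟨w, hw⟩ : ∃ w, w ∈ t ∧ t.erase w = s.erase v := by
    have h1 : (t \ s.erase v).card = 1 := by
      rw [Finset.card_sdiff_of_subset hsub, hcard, htc]; omega
    obtain ⟨w, hw⟩ := Finset.card_eq_one.mp h1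
    refine ⟨w, (Finset.mem_sdiff.mp (hw ▸ Finset.mem_singleton_self w)).1, ?_⟩
    rw [Finset.erase_eq, ← hw, Finset.sdiff_sdiff_eq_self hsub]
  refine ⟨⟨t, w, ⟨htf, htc⟩, hw.1⟩, ⟨fun e => hts (congrArg HalfEdge.simplex e), hw.2⟩, ?_⟩
  rintro ⟨u, x, ⟨huf, huc⟩, hx⟩ ⟨hne, hfac⟩
  have hfac : u.erase x = s.erase v := hfac
  have hu : u = s ∨ u = t := (ht u).mp ⟨huf, huc, hfac ▸ Finset.erase_subset x u⟩
  rcases hu with rfl | rfl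
  · exfalso
    apply hne
    have : x = v := (Finset.erase_inj u hx).mp hfac
    subst this; rfl
  · have : x = w := (Finset.erase_inj u hx).mp (hfac.trans hw.2.symm)
    subst this; rfl

/-- The other half of the dual edge that contains the half-edge `h`. -/
def glue (M : BranchedTriangulation V d) (h : M.HalfEdge) : M.HalfEdge :=
  if e : ∃ h' : M.HalfEdge, h' ≠ h ∧ M.facet h' = M.facet h then e.choose else h

/-- Relative to a labelling of the `d`-simplices by signs, the facet of `h` belongs to the
representative of `w₁`: the orientations that the two adjacent `d`-simplices (branching orientation
times label) induce on it do not cancel. -/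
def OnW1 (M : BranchedTriangulation V d) (sign : Finset V → ℤˣ) (h : M.HalfEdge) : Prop :=
  sign h.simplex * (-1) ^ M.index h = sign (M.glue h).simplex * (-1) ^ M.index (M.glue h)

/-- The choices that enter the background framing of `TM ⊕ det TM`: a label `±` for every
`d`-simplex, and at every dual edge through `w₁` the direction in which the background orientation
vector points while it crosses the wall. `cross h = 1` if this is the direction out of the simplex of
`h`, and `cross h = -1` if it is the direction into it. -/
structure FramingChoice (M : BranchedTriangulation V d) where
  sign : Finset V → ℤˣ
  cross : M.HalfEdge → ℤˣ
  cross_glue : ∀ h, M.OnW1 sign h → cross (M.glue h) = - cross h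

end BranchedTriangulation

/-! ### The framings along a path `î → ĵ` in a `d`-simplex

The path is parametrised by `t ∈ [0, 3]`: `[0, 1]` runs from the facet `î` towards the centre,
`[1, 2]` passes from the edge `î` to the edge `ĵ` close to the centre, and `[2, 3]` runs on to the
facet `ĵ`. Rows are vectors of `ℝ^{d+1}`, taken modulo `(1, …, 1)`, which is row `0`. -/

/-- The parameter of the passage from `î` to `ĵ`. -/
def turn (t : ℝ) : ℝ := max 0 (min 1 (t - 1))

/-- The component `m` of `b_k = (1, 1/2^k, …, 1/(d+1)^k)`, whose `i`-th (`j`-th) component is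
projected out on the way to the facet `î` (`ĵ`) if `k ≥ 1`. -/
def momentVector (i j : ℕ) (t : ℝ) (k m : ℕ) : ℝ :=
  (if k = 0 then 1 else if m = i then min 1 t else if m = j then min 1 (3 - t) else 1) *
    (1 / ((m : ℝ) + 1) ^ k)

/-- The unit vector `e_i ∼ d (c - f_i)` along `î`. -/
def unitVector (i m : ℕ) : ℝ := if m = i then 1 else 0

/-- The background framing: the shared vectors `b_0, …, b_{d-2}`, then `b_{d-1}`, and last the vector
along the 1-skeleton. Here `s` is the label of the simplex. -/
def bkgdFrame (d : ℕ) (s : ℤˣ) (i j : ℕ) (t : ℝ) : Matrix (Fin (d + 1)) (Fin (d + 1)) ℝ :=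
  Matrix.of fun k m =>
    if (k : ℕ) < d then momentVector i j t k m
    else ((s : ℤ) : ℝ) *
      ((1 - turn t) * ((-1) ^ (i + d + d.choose 2) / d * unitVector i m) +
        turn t * ((-1) ^ (j + d + d.choose 2) / d * unitVector j m))

/-- The sign of the `(d-1)`-st vector of the tangent framing. Here `s` is the label of the simplex and
`ε = 1` (`ε = -1`) if the orientation vectors of the two framings agree (disagree). -/
def tangSign (d : ℕ) (s ε : ℤˣ) (i j : ℕ) : ℝ :=
  ((s : ℤ) : ℝ) * ((ε : ℤ) : ℝ) * (-1) ^ (i + j + (d - 1).choose 2 + if j < i then 1 else 0)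

/-- The tangent framing: the shared vectors `b_0, …, b_{d-2}`, then the vector that spans together
with the tangent the dual 2-cell `(ij)`, and last the tangent vector of the path. -/
def tangFrame (d : ℕ) (s ε : ℤˣ) (i j : ℕ) (t : ℝ) : Matrix (Fin (d + 1)) (Fin (d + 1)) ℝ :=
  Matrix.of fun k m =>
    if (k : ℕ) + 1 < d then momentVector i j t k m
    else if (k : ℕ) + 1 = d then
      tangSign d s ε i j / d * (turn t * unitVector i m + (1 - turn t) * unitVector j m)
    else 1 / d * ((1 - turn t) * unitVector i m - turn t * unitVector j m)

/-- The relative framing: the rows of the background framing in terms of the tangent framing. It is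
the identity on the shared vectors. -/
def relFrame (d : ℕ) (s ε : ℤˣ) (i j : ℕ) (t : ℝ) : Matrix (Fin (d + 1)) (Fin (d + 1)) ℝ :=
  bkgdFrame d s i j t * (tangFrame d s ε i j t)⁻¹

/-- The last background vector modulo the shared vectors, as a vector in the plane that is spanned by
the last two tangent vectors (real axis: the tangent of the path). At both ends of the path it is
real. The sign is the convention for the sense of rotation in this plane. -/
def relVector (d : ℕ) (s ε : ℤˣ) (i j : ℕ) (t : ℝ) : ℂ :=
  (relFrame d s ε i j t (Fin.last d) (Fin.last d) : ℂ) +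
    (-1) ^ (d - 1).choose 2 *
      (relFrame d s ε i j t (Fin.last d) ⟨d - 1, by omega⟩ : ℂ) * Complex.I

/-- The total change of the argument of the nowhere vanishing path `r` on `[a, b]`, computed from any
continuous choice of the argument. -/
def argChange (r : ℝ → ℂ) (a b : ℝ) : ℝ :=
  if h : ∃ θ : ℝ → ℝ, ContinuousOn θ (Set.Icc a b) ∧
      ∀ t ∈ Set.Icc a b, r t = ‖r t‖ * Complex.exp (θ t * Complex.I)
  then h.choose b - h.choose a else 0

/-- The winding angle of the background framing with respect to the tangent framing along `î → ĵ`. -/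
def winding (d : ℕ) (s ε : ℤˣ) (i j : ℕ) : ℝ := argChange (relVector d s ε i j) 0 3

/-! ### Winding matrices -/

def pauliX : Matrix (Fin 2) (Fin 2) ℂ := !![0, 1; 1, 0]

def pauliY : Matrix (Fin 2) (Fin 2) ℂ := !![0, -Complex.I; Complex.I, 0]

/-- `exp (i θ X / 2)`: the end point in `SU(2)` of the lift of the rotation by `θ` about the
orientation vector. -/
def liftX (θ : ℝ) : Matrix (Fin 2) (Fin 2) ℂ :=
  (Real.cos (θ / 2) : ℂ) • 1 + (Complex.I * (Real.sin (θ / 2) : ℂ)) • pauliX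

/-- Matrices of `2 × 2` blocks that act on the pairs `(O_same, O_opposite)`. -/
abbrev WindingMatrix := Matrix (Fin 2) (Fin 2) (Matrix (Fin 2) (Fin 2) ℂ)

/-- The winding matrix of the passage `î → ĵ` through a `d`-simplex with label `s`. -/
def simplexMatrix (d : ℕ) (s : ℤˣ) (i j : ℕ) : WindingMatrix :=
  !![liftX (winding d s 1 i j), 0; 0, liftX (winding d s (-1) i j)]

/-- The winding matrix of a crossing of `w₁`: the background frame makes a half turn in the plane of
the orientation vector and the vector along the 1-skeleton, and the two orientation vectors go over
from agreeing to disagreeing or back. Here `c = 1` (`c = -1`) if the path runs in (against) the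
direction of the background orientation vector on the wall. -/
def crossMatrix (c : ℤˣ) : WindingMatrix :=
  !![0, (((c : ℤ) : ℂ) * Complex.I) • pauliY; -((((c : ℤ) : ℂ) * Complex.I) • pauliY), 0]

/-! ### Trivalent resolutions -/

/-- Plane binary trees whose leaves carry labels. -/
inductive PlaneTree : Type
  | leaf (i : ℕ) : PlaneTree
  | node (l r : PlaneTree) : PlaneTree

namespace PlaneTree

/-- The leaves from left to right. -/
def leaves : PlaneTree → List ℕ
  | leaf i => [i]
  | node l r => l.leaves ++ r.leaves

/-- The legs of a vertex of the dual 1-skeleton other than `0̂`, in cyclic order after `0̂`, in the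
picture in which the even legs point up and increase from left to right while the odd legs point down
and increase from right to left: `2, 4, 6, …, 1, 3, 5, …`. -/
def legs (d : ℕ) : List ℕ :=
  ((List.range (d + 1)).filter fun i => i ≠ 0 ∧ i % 2 = 0) ++
    (List.range (d + 1)).filter fun i => i % 2 = 1

/-- The leaf at the open end of the strand that leaves the tree through its root, if there is one,
when the strands end at the leaves in `S`: at a trivalent vertex either no or two edges are used. -/
def openEnd (S : ℕ → Prop) : PlaneTree → Option ℕ
  | leaf i => if S i then some i else none
  | node l r =>
    match l.openEnd S, r.openEnd S with
    | some a, none => some a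
    | none, some b => some b
    | _, _ => none

/-- Two leaves in `S` are joined by a strand inside the tree. -/
def Joined (S : ℕ → Prop) : PlaneTree → ℕ → ℕ → Prop
  | leaf _, _, _ => False
  | node l r, a, b => l.Joined S a b ∨ r.Joined S a b ∨
      (l.openEnd S = some a ∧ r.openEnd S = some b) ∨ (l.openEnd S = some b ∧ r.openEnd S = some a)

theorem exists_leaves : ∀ L : List ℕ, L ≠ [] → ∃ t : PlaneTree, t.leaves = L
  | [], h => absurd rfl h
  | [i], _ => ⟨leaf i, rfl⟩
  | i :: j :: L, _ => by
    obtain ⟨t, ht⟩ := exists_leaves (j :: L) (by simp)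
    exact ⟨node (leaf i) t, by simp [leaves, ht]⟩

end PlaneTree

/-- A trivalent resolution of the `(d+1)`-valent vertex: a plane trivalent tree whose legs are
`0̂, 2̂, 4̂, …, 1̂, 3̂, 5̂, …` in cyclic order. The tree is cut open at the leg `0̂`, which is the root. -/
structure Resolution (d : ℕ) where
  tree : PlaneTree
  leaves_eq : tree.leaves = PlaneTree.legs d

instance (d : ℕ) : Nonempty (Resolution (d + 2)) := by
  obtain ⟨t, ht⟩ := PlaneTree.exists_leaves (PlaneTree.legs (d + 2)) (by
    apply List.ne_nil_of_mem (a := 1)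
    simp [PlaneTree.legs])
  exact ⟨⟨t, ht⟩⟩

/-- The legs `a` and `b` in `S` belong to the same strand after the resolution. -/
def Resolution.Joined (R : Resolution d) (S : ℕ → Prop) (a b : ℕ) : Prop :=
  R.tree.Joined S a b ∨
    (S 0 ∧ ((a = 0 ∧ R.tree.openEnd S = some b) ∨ (b = 0 ∧ R.tree.openEnd S = some a)))

/-! ### Loops and the weight -/

namespace BranchedTriangulation

variable (M : BranchedTriangulation V d)

/-- The labels of the half-edges in the simplex `s` that belong to the dual of `α`. -/
def Occupied {p : ℕ} (α : M.Cochain p) (s : Finset V) (i : ℕ) : Prop :=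
  ∃ v ∈ s, M.pos s v = i ∧ M.ev α (s.erase v) = 1

/-- The half-edge through which the strand that enters a simplex through `h` leaves it. -/
def exit (R : Finset V → Resolution d) {p : ℕ} (α : M.Cochain p) (h : M.HalfEdge) : M.HalfEdge :=
  if e : ∃ h' : M.HalfEdge, h'.simplex = h.simplex ∧
      (R h.simplex).Joined (M.Occupied α h.simplex) (M.index h) (M.index h')
  then e.choose else h

/-- The half-edge through which that strand enters the next simplex. -/
def next (R : Finset V → Resolution d) {p : ℕ} (α : M.Cochain p) (h : M.HalfEdge) : M.HalfEdge :=
  M.glue (M.exit R α h)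

/-- The winding matrix from the moment of entering a simplex through `h` to the moment of entering
the next one. On the passage through a facet outside `w₁` the last vectors of both framings stay
parallel to the dual edge, so that nothing winds there. -/
def stepMatrix (F : M.FramingChoice) (R : Finset V → Resolution d) {p : ℕ} (α : M.Cochain p)
    (h : M.HalfEdge) : WindingMatrix :=
  (if M.OnW1 F.sign (M.exit R α h) then crossMatrix (F.cross (M.exit R α h)) else 1) *
    simplexMatrix d (F.sign h.simplex) (M.index h) (M.index (M.exit R α h))

/-- The winding matrix `W_k ⋯ W_1` once around the loop that enters a simplex through `h`. -/
def loopMatrix (F : M.FramingChoice) (R : Finset V → Resolution d) {p : ℕ} (α : M.Cochain p)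
    (h : M.HalfEdge) : WindingMatrix :=
  ((List.range (Function.minimalPeriod (M.next R α) h)).map
    fun k => M.stepMatrix F R α ((M.next R α)^[k] h)).reverse.prod

/-- The factor `i ^ (number of right half-twists)` of the loop that enters a simplex through `h`: the
upper left entry of `O_same + O_opposite`, where `O` is the image of `(1, 0)`. -/
def loopPhase (F : M.FramingChoice) (R : Finset V → Resolution d) {p : ℕ} (α : M.Cochain p)
    (h : M.HalfEdge) : ℂ :=
  (M.loopMatrix F R α h 0 0 + M.loopMatrix F R α h 1 0) 0 0

/-- The half-edges in the dual of `α`. -/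
abbrev Occ {p : ℕ} (α : M.Cochain p) : Type _ := {h : M.HalfEdge // M.ev α (M.facet h) = 1}

/-- The (undirected) loops into which the dual of `α` is decomposed by the trivalent resolutions. -/
def Loops (R : Finset V → Resolution d) {p : ℕ} (α : M.Cochain p) : Type _ :=
  Quot fun h h' : M.Occ α => h'.1 = M.exit R α h.1 ∨ h'.1 = M.glue h.1

/-- The loop through a half-edge. -/
def loopOf (R : Finset V → Resolution d) {p : ℕ} (α : M.Cochain p) (h : M.Occ α) : M.Loops R α :=
  Quot.mk _ h

/-- `σ(M, α) = (-1)^{# of loops} ∏_{loops} i^{number of right half-twists}`; every loop is traversed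
from some half-edge `Quot.out ℓ` on it. -/
def sigma (F : M.FramingChoice) (R : Finset V → Resolution d) {p : ℕ} (α : M.Cochain p) : ℂ :=
  (-1) ^ Nat.card (M.Loops R α) * ∏ᶠ ℓ : M.Loops R α, M.loopPhase F R α (Quot.out ℓ).1

end BranchedTriangulation

end LoopWeight

end

/-!
The loop weight is shown to be a quadratic refinement: `σ(α)` is a product of local scalars times
`(-1) ^ q(α)` for an explicit quadratic form `q` in the values of `α`, and the polarisation of `q`
is compared with the `∪_{d-2}` product one simplex at a time.

*Local scalars.* Modulo the shared vectors, the last background vector is an explicit combination of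
the last two tangent vectors (`relVector_eq`). It does not turn if the two half-edges have different
parity and makes a half turn `±π` if they have equal parity (`winding_of_odd`, `winding_of_even`).
All winding matrices therefore permute, up to scalars, the two rows `stateRow 1` and
`stateRow (-1)`, the first of which reads off the upper left entry of `O_same + O_opposite`. Whether
the row changes in a step is recorded by the local orientations `frameSign`, so the row is restored
after a full loop, and the phase of a loop is the product of the scalars of its steps
(`loopPhase_eq`). The scalar of a passage from one leg to another is a factor for each of the two
legs times the sign of the two legs in the order `0̂, 2̂, 4̂, …, 1̂, 3̂, 5̂, …` (`stepWeight_eq`).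
The leg factors of the two halves of a dual edge combine to a weight that changes its sign with the
direction (`edgeWeight_glue`), that is, to a weight of the undirected edge times the sign of its two
halves in an arbitrary order of the half-edges. A reversal of a loop changes all these signs, two
for every step, so the phase depends on the loop alone (`prod_loop_eq_of_mk_eq`).

*The number of loops.* The used half-edges carry two perfect matchings: by strands inside the
simplices and by dual edges. The loops are the cycles of a permutation of one end per strand, so
`(-1) ^ #loops` is, up to `(-1) ^ #strands`, the sign of this permutation. The half-edges are listed
in two ways: simplex by simplex, by leg order inside each simplex (the rank `r`), and edge by edge
(the rank `r'`). The strands of a planar tree do not cross in the first order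
(`Resolution.Joined.sign_joined`), and the edges do not cross in the second one. For noncrossing
matchings the sign of the permutation is the product of the orders of the matched pairs and of the
sign that compares the two lists (`prod_inversionSign`). The orders of the matched pairs are those
in the loop phases. All of them cancel, and what remains is a product of edge weights and
`(-1) ^ #inversions` (`prod_loops`, `sigma_eq`).

*Polarisation.* The number of inversions is a quadratic form in the cocycle whose polarisation is
the sum of the two orders, as bilinear forms (`inversions_add`). As the sum of a cocycle over the
facets of a simplex vanishes, and likewise its sum over the two halves of an edge, only pairs in one
simplex or in one edge contribute (`sum_before_mul`). The edge terms together with the squares of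
the edge weights amount to the sum of the indices of the half-edges used by both cocycles
(`sum_before_glue`). On one simplex, the leg order between half-edges of equal parity is the vertex
order, which is what occurs in `∪_{d-2}`; the cocycle condition removes the pairs of different
parity at the cost of diagonal terms, which are the index terms (`cup_sum_eq`, `integral_cup`).
-/

namespace LoopWeight

open Finset

/-! ### Signs of permutations and pairs of perfect matchings -/

theorem sign_sigmaCongrRight {ι : Type*} [Fintype ι] [DecidableEq ι] {β : ι → Type*}
    [∀ i, Fintype (β i)] [∀ i, DecidableEq (β i)] (σ : ∀ i, Equiv.Perm (β i)) :
    Equiv.Perm.sign (Equiv.Perm.sigmaCongrRight σ) = ∏ i, Equiv.Perm.sign (σ i) := by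
  have h : (Equiv.Perm.sign.comp (Equiv.Perm.sigmaCongrRightHom β)) =
      ∏ i, Equiv.Perm.sign.comp (Pi.evalMonoidHom (fun i => Equiv.Perm (β i)) i) := by
    refine MonoidHom.pi_ext fun i τ => ?_
    rw [MonoidHom.finsetProd_apply, Finset.prod_eq_single i]
    · simp only [MonoidHom.comp_apply, Pi.evalMonoidHom_apply, Pi.mulSingle_eq_same]
      refine (Equiv.Perm.sign_bij (fun a _ => ⟨i, a⟩) ?_ ?_ ?_).symm
      · intro a _ _
        simp [Equiv.Perm.sigmaCongrRightHom]
      · intro a b _ _ hab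
        simpa using hab
      · rintro ⟨j, a⟩ hja
        by_cases hij : j = i
        · subst hij
          exact ⟨a, by simpa [Equiv.Perm.sigmaCongrRightHom] using hja, rfl⟩
        · exact absurd (by simp [Equiv.Perm.sigmaCongrRightHom, hij]) hja
    · intro j _ hj
      simp [Pi.mulSingle_eq_of_ne hj]
    · simp
  simpa using DFunLike.congr_fun h σ

/-- The sign `+1`, `-1` or `0` according to whether `a` comes before, after or in the same place as
`b` in the order given by the rank `r`. -/
def ordSign {A : Type*} (r : A → ℤ) (a b : A) : ℤ := Int.sign (r b - r a)

theorem ordSign_swap {A : Type*} (r : A → ℤ) (a b : A) : ordSign r a b = -ordSign r b a := by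
  rw [ordSign, ordSign, ← Int.sign_neg, neg_sub]

/-- `-1` if the ranks `r` and `r'` put `a`, `b` in this order and in the opposite order,
respectively, and `1` otherwise. -/
def inversionSign {A : Type*} (r r' : A → ℤ) (a b : A) : ℤ :=
  if r a < r b ∧ r' b < r' a then -1 else 1

theorem inversionSign_mul_swap {A : Type*} {r r' : A → ℤ} (hr : r.Injective) (hr' : r'.Injective)
    {a b : A} (hab : a ≠ b) :
    inversionSign r r' a b * inversionSign r r' b a = ordSign r a b * ordSign r' a b := by
  have h1 : r a ≠ r b := fun h => hab (hr h)
  have h2 : r' a ≠ r' b := fun h => hab (hr' h)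
  unfold inversionSign ordSign
  rcases lt_or_gt_of_ne h1 with h1 | h1 <;> rcases lt_or_gt_of_ne h2 with h2 | h2
  · rw [Int.sign_eq_one_of_pos (sub_pos.2 h1), Int.sign_eq_one_of_pos (sub_pos.2 h2)]
    simp [h1.not_gt, h2.not_gt]
  · rw [Int.sign_eq_one_of_pos (sub_pos.2 h1), Int.sign_eq_neg_one_of_neg (sub_neg.2 h2)]
    simp [h1, h2, h1.not_gt]
  · rw [Int.sign_eq_neg_one_of_neg (sub_neg.2 h1), Int.sign_eq_one_of_pos (sub_pos.2 h2)]
    simp [h1, h2, h1.not_gt]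
  · rw [Int.sign_eq_neg_one_of_neg (sub_neg.2 h1), Int.sign_eq_neg_one_of_neg (sub_neg.2 h2)]
    simp [h1.not_gt, h2.not_gt]

theorem prod_prod_eq_prod_Ioi {m : ℕ} {R : Type*} [CommMonoid R] (f : Fin m → Fin m → R) :
    ∏ i, ∏ j, f i j = (∏ i, f i i) * ∏ i, ∏ j ∈ Ioi i, f j i * f i j := by
  rw [Finset.prod_prod_Ioi_mul_eq_prod_prod_off_diag, ← Finset.prod_mul_distrib,
    Finset.prod_comm]
  refine Finset.prod_congr rfl fun i _ => ?_
  rw [← Finset.prod_compl_mul_prod {i}, Finset.prod_singleton, mul_comm]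

/-- If the pairs `(p i, q i)` do not cross each other, then in the product of the signs of all pairs
of the `2m` points only the pairs `(p i, q i)` and a sign for every two indices survive. -/
theorem prod_sign_of_noncrossing {m : ℕ} {A : Type*} {K : A → A → ℤ}
    (hK : ∀ a b, K a b = -K b a) {p q : Fin m → A}
    (hpq : ∀ i j, i ≠ j → K (p i) (p j) * K (p i) (q j) * K (q i) (p j) * K (q i) (q j) = 1) :
    (∏ i, ∏ j ∈ Ioi i, K (p i) (p j) * K (q i) (q j)) * ∏ i, ∏ j, K (p i) (q j) =
      (∏ i : Fin m, ∏ _j ∈ Ioi i, (-1 : ℤ)) * ∏ i, K (p i) (q i) := by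
  rw [prod_prod_eq_prod_Ioi, mul_left_comm, ← Finset.prod_mul_distrib, mul_comm]
  congr 1
  refine Finset.prod_congr rfl fun i _ => ?_
  rw [← Finset.prod_mul_distrib]
  refine Finset.prod_congr rfl fun j hj => ?_
  rw [hK (p j) (q i), ← hpq i j (ne_of_lt (mem_Ioi.1 hj))]
  ring

/-- The sign lemma for two perfect matchings `(p i, q i)` and `(p (σ i), q i)` of the same points
that do not cross for two orders `r` and `r'` of the points, respectively. The product of the signs
of all pairs of points in the order `r` reduces to a sign for every two indices and the signs of the
pairs of the first matching; the same holds for `r'` and the second matching, where the sign of `σ`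
enters because the points are labelled by the first one. -/
theorem prod_inversionSign_fin {m : ℕ} {A : Type*} [Fintype A] {r r' : A → ℤ}
    (hr : r.Injective) (hr' : r'.Injective) {p q : Fin m → A}
    (hbij : (Sum.elim p q).Bijective) (σ : Equiv.Perm (Fin m))
    (h : ∀ i j, i ≠ j → ordSign r (p i) (p j) * ordSign r (p i) (q j) * ordSign r (q i) (p j) *
      ordSign r (q i) (q j) = 1)
    (h' : ∀ i j, i ≠ j → ordSign r' (p (σ i)) (p (σ j)) * ordSign r' (p (σ i)) (q j) *
      ordSign r' (q i) (p (σ j)) * ordSign r' (q i) (q j) = 1) :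
    ∏ a, ∏ b, inversionSign r r' a b =
      (Equiv.Perm.sign σ : ℤ) * ∏ i, ordSign r (p i) (q i) * ordSign r' (p (σ i)) (q i) := by
  have hp : p.Injective := fun i j e => Sum.inl_injective (hbij.1 e)
  have hq : q.Injective := fun i j e => Sum.inr_injective (hbij.1 e)
  have hne : ∀ i j, p i ≠ q j := fun i j e =>
    Sum.inl_ne_inr (hbij.1 (a₁ := .inl i) (a₂ := .inr j) e)
  have hA : ∀ f : A → ℤ, ∏ a, f a = (∏ i, f (p i)) * ∏ i, f (q i) := by
    intro f
    rw [← Fintype.prod_bijective _ hbij (fun x => f (Sum.elim p q x)) f fun _ => rfl,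
      Fintype.prod_sum_type]
    rfl
  have hself : ∀ s : Fin m → A, s.Injective → ∏ i, ∏ j, inversionSign r r' (s i) (s j) =
      ∏ i, ∏ j ∈ Ioi i, ordSign r (s i) (s j) * ordSign r' (s i) (s j) := by
    intro s hs
    rw [prod_prod_eq_prod_Ioi]
    have : ∏ i, inversionSign r r' (s i) (s i) = 1 :=
      Finset.prod_eq_one fun i _ => by simp [inversionSign]
    rw [this, one_mul]
    refine Finset.prod_congr rfl fun i _ => Finset.prod_congr rfl fun j hj => ?_
    rw [mul_comm, inversionSign_mul_swap hr hr' fun e => (mem_Ioi.1 hj).ne (hs e)]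
  have e1 := prod_sign_of_noncrossing (ordSign_swap r) h
  have e2 := prod_sign_of_noncrossing (p := p ∘ σ) (ordSign_swap r') h'
  have e3 := σ.prod_Ioi_comp_eq_sign_mul_prod
    (f := fun i j => ordSign r' (p i) (p j)) fun i j => ordSign_swap r' _ _
  have e4 : ∏ i, ∏ j, ordSign r' (p (σ i)) (q j) = ∏ i, ∏ j, ordSign r' (p i) (q j) :=
    Equiv.prod_comp σ fun i => ∏ j, ordSign r' (p i) (q j)
  have e5 : (∏ i : Fin m, ∏ j ∈ Ioi i, (-1 : ℤ)) * (∏ i : Fin m, ∏ j ∈ Ioi i, (-1 : ℤ)) = 1 := by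
    simp only [← Finset.prod_mul_distrib]
    exact Finset.prod_eq_one fun i _ => Finset.prod_eq_one fun j _ => by norm_num
  have e6 : ((Equiv.Perm.sign σ : ℤˣ) : ℤ) * (Equiv.Perm.sign σ : ℤˣ) = 1 := by
    rw [← Units.val_mul, Int.units_mul_self]; rfl
  simp only [Function.comp_apply, Finset.prod_mul_distrib] at e1 e2
  rw [e3, e4, Int.cast_id] at e2
  have e7 : (∏ i, ∏ j, inversionSign r r' (p i) (q j)) *
      ∏ i, ∏ j, inversionSign r r' (q i) (p j) =
      (∏ i, ∏ j, ordSign r (p i) (q j)) * ∏ i, ∏ j, ordSign r' (p i) (q j) := by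
    rw [Finset.prod_comm (f := fun i j => inversionSign r r' (q i) (p j))]
    simp only [← Finset.prod_mul_distrib]
    exact Finset.prod_congr rfl fun i _ => Finset.prod_congr rfl fun j _ =>
      inversionSign_mul_swap hr hr' (hne i j)
  rw [hA]
  simp only [hA (inversionSign r r' _), Finset.prod_mul_distrib, hself p hp, hself q hq] at e7 ⊢
  generalize (∏ i, ∏ j, inversionSign r r' (p i) (q j)) = y1 at *
  generalize (∏ i, ∏ j, inversionSign r r' (q i) (p j)) = y2 at *
  generalize (∏ i : Fin m, ∏ j ∈ Ioi i, (-1 : ℤ)) = c at *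
  generalize (∏ i, ∏ j ∈ Ioi i, ordSign r (p i) (p j)) = a1 at *
  generalize (∏ i, ∏ j ∈ Ioi i, ordSign r' (p i) (p j)) = a2 at *
  generalize (∏ i, ∏ j ∈ Ioi i, ordSign r (q i) (q j)) = b1 at *
  generalize (∏ i, ∏ j ∈ Ioi i, ordSign r' (q i) (q j)) = b2 at *
  generalize (∏ i, ∏ j, ordSign r (p i) (q j)) = d1 at *
  generalize (∏ i, ∏ j, ordSign r' (p i) (q j)) = d2 at *
  generalize (∏ i, ordSign r (p i) (q i)) = f1 at *
  generalize (∏ i, ordSign r' (p (σ i)) (q i)) = f2 at *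
  generalize (((Equiv.Perm.sign σ : ℤˣ) : ℤ)) = s at *
  calc a1 * a2 * y1 * (y2 * (b1 * b2)) = a1 * a2 * b1 * b2 * (y1 * y2) := by ring
    _ = (a1 * b1 * d1) * (s * a2 * b2 * d2) * s := by
          rw [e7]
          linear_combination (-(a1 * a2 * b1 * b2 * d1 * d2)) * e6
    _ = s * (f1 * f2) := by rw [e1, e2]; linear_combination (s * f1 * f2) * e5

/-- `prod_inversionSign_fin` for an index type without an order. -/
theorem prod_inversionSign {ι A : Type*} [Fintype ι] [DecidableEq ι] [Fintype A] {r r' : A → ℤ}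
    (hr : r.Injective) (hr' : r'.Injective) {p q : ι → A}
    (hbij : (Sum.elim p q).Bijective) (σ : Equiv.Perm ι)
    (h : ∀ i j, i ≠ j → ordSign r (p i) (p j) * ordSign r (p i) (q j) * ordSign r (q i) (p j) *
      ordSign r (q i) (q j) = 1)
    (h' : ∀ i j, i ≠ j → ordSign r' (p (σ i)) (p (σ j)) * ordSign r' (p (σ i)) (q j) *
      ordSign r' (q i) (p (σ j)) * ordSign r' (q i) (q j) = 1) :
    ∏ a, ∏ b, inversionSign r r' a b =
      (Equiv.Perm.sign σ : ℤ) * ∏ i, ordSign r (p i) (q i) * ordSign r' (p (σ i)) (q i) := by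
  let e := Fintype.equivFin ι
  have := prod_inversionSign_fin hr hr' (p := p ∘ e.symm) (q := q ∘ e.symm)
    (by
      convert hbij.comp (Equiv.sumCongr e.symm e.symm).bijective using 1
      ext (x | x) <;> rfl)
    (e.permCongr σ) (fun i j hij => h _ _ (e.symm.injective.ne hij))
    (fun i j hij => by
      simpa using h' _ _ (e.symm.injective.ne hij))
  rw [this, Equiv.Perm.sign_permCongr]
  congr 1
  refine Fintype.prod_equiv e.symm _ _ fun i => ?_
  simp

/-! ### Loops of two involutions -/

/-- The step along a periodic orbit is the rotation of the exponents. -/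
theorem iterate_finRotate {A : Type*} {f : A → A} {x : A} :
    ∀ {n : ℕ}, Function.IsPeriodicPt f n x → ∀ k : Fin n, f^[finRotate n k] x = f (f^[k] x)
  | 0, _, k => k.elim0
  | n + 1, hx, k => by
    rw [coe_finRotate, ← Function.iterate_succ_apply' f]
    split_ifs with hk
    · rw [hk]
      exact hx.symm
    · rfl

section Involutions

variable {A : Type*} {e g : A → A}

/-- A loop of two fixed point free involutions never turns back: an element and its image under one
of the involutions belong to different orbits of the composition. -/
theorem iterate_ne_involution (he : ∀ a, e (e a) = a) (he' : ∀ a, e a ≠ a) (hg : ∀ a, g (g a) = a)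
    (hg' : ∀ a, g a ≠ a) : ∀ (k : ℕ) (a : A), (g ∘ e)^[k] a ≠ e a
  | 0, a => (he' a).symm
  | 1, a => hg' (e a)
  | k + 2, a => by
    intro h
    rw [Function.iterate_succ_apply', Function.iterate_succ_apply] at h
    have h1 := congrArg g h
    simp only [Function.comp_apply, hg] at h1
    refine iterate_ne_involution he he' hg hg' k (g (e a)) ?_
    exact (he _).symm.trans (congrArg e h1)

theorem iterate_ne_involution_iterate (he : ∀ a, e (e a) = a) (he' : ∀ a, e a ≠ a)
    (hg : ∀ a, g (g a) = a) (hg' : ∀ a, g a ≠ a) (k l : ℕ) (a : A) :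
    (g ∘ e)^[k] a ≠ e ((g ∘ e)^[l] a) := by
  rcases le_total l k with h | h
  · obtain ⟨m, rfl⟩ := Nat.exists_eq_add_of_le' h
    rw [Function.iterate_add_apply]
    exact iterate_ne_involution he he' hg hg' _ _
  · obtain ⟨m, rfl⟩ := Nat.exists_eq_add_of_le' h
    rw [Function.iterate_add_apply]
    intro e1
    have e2 := congrArg e e1
    rw [he] at e2
    exact iterate_ne_involution he he' hg hg' m _ e2.symm

variable (e g) in
/-- The loops into which two involutions `e` and `g` decompose a set: the orbits of the group that
they generate. -/
abbrev InvolutionLoops : Type _ := Quot fun a b : A => b = e a ∨ b = g a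

theorem minimalPeriod_pos_of_involutions [Finite A] (he : ∀ a, e (e a) = a)
    (hg : ∀ a, g (g a) = a) (a : A) : 0 < Function.minimalPeriod (g ∘ e) a :=
  Function.minimalPeriod_pos_of_mem_periodicPts <|
    ((Function.LeftInverse.injective hg).comp
      (Function.LeftInverse.injective he)).mem_periodicPts a

/-- A loop, traversed from one of its elements, runs through one end of each of its pairs. -/
theorem exists_iterate_of_mk_eq [Finite A] (he : ∀ a, e (e a) = a) (hg : ∀ a, g (g a) = a)
    {a b : A} (hab : (Quot.mk _ a : InvolutionLoops e g) = Quot.mk _ b) :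
    ∃ k < Function.minimalPeriod (g ∘ e) a, b = (g ∘ e)^[k] a ∨ b = e ((g ∘ e)^[k] a) := by
  set n := Function.minimalPeriod (g ∘ e) a with hn
  have hpos : 0 < n := minimalPeriod_pos_of_involutions he hg a
  suffices h : ∃ k, b = (g ∘ e)^[k] a ∨ b = e ((g ∘ e)^[k] a) by
    obtain ⟨k, hk⟩ := h
    refine ⟨k % n, Nat.mod_lt _ hpos, ?_⟩
    rwa [Function.iterate_mod_minimalPeriod_eq]
  let P : A → Prop := fun b => ∃ k, b = (g ∘ e)^[k] a ∨ b = e ((g ∘ e)^[k] a)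
  have hPe : ∀ b, P b → P (e b) := by
    rintro b ⟨k, rfl | rfl⟩
    · exact ⟨k, Or.inr rfl⟩
    · exact ⟨k, Or.inl (he _)⟩
  have hPg : ∀ b, P b → P (g b) := by
    rintro b ⟨k, rfl | rfl⟩
    · refine ⟨k + n - 1, Or.inr ?_⟩
      have h1 : (g ∘ e)^[k] a = (g ∘ e)^[k + n - 1 + 1] a := by
        rw [show k + n - 1 + 1 = k + n by omega, hn, Function.iterate_add_minimalPeriod_eq]
      rw [h1, Function.iterate_succ_apply']
      exact hg _
    · exact ⟨k + 1, Or.inl (Function.iterate_succ_apply' (g ∘ e) k a).symm⟩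
  have hP : ∀ b c, (c = e b ∨ c = g b) → P b = P c := by
    rintro b c (rfl | rfl)
    · exact propext ⟨hPe b, fun h => he b ▸ hPe _ h⟩
    · exact propext ⟨hPg b, fun h => hg b ▸ hPg _ h⟩
  have := congrArg (Quot.lift P hP) hab
  exact this.mp ⟨0, Or.inl rfl⟩

/-- The sign of a system of loops: `(-1)` to the number of loops, times weights `w` along every loop
that factor through the order `r` at the pairs of `e` and the order `r'` at the pairs of `g`,
is a product over all elements and over all inversions between the two orders. -/
theorem prod_loops [Fintype A] (he : ∀ a, e (e a) = a) (he' : ∀ a, e a ≠ a)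
    (hg : ∀ a, g (g a) = a) (hg' : ∀ a, g a ≠ a) {r r' : A → ℤ} (hr : r.Injective)
    (hr' : r'.Injective)
    (h : ∀ a b, b ≠ a → b ≠ e a → ordSign r a b * ordSign r a (e b) * ordSign r (e a) b *
      ordSign r (e a) (e b) = 1)
    (h' : ∀ a b, b ≠ a → b ≠ g a → ordSign r' a b * ordSign r' a (g b) * ordSign r' (g a) b *
      ordSign r' (g a) (g b) = 1)
    {w x y u : A → ℂ} (hw : ∀ a, w a = ordSign r a (e a) * (x a * y (e a)))
    (hu : ∀ a, x (g a) * y a = ordSign r' a (g a) * (u a * u (g a))) :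
    (-1) ^ Nat.card (InvolutionLoops e g) *
      ∏ᶠ l : InvolutionLoops e g, ∏ k ∈ range (Function.minimalPeriod (g ∘ e) l.out),
        w ((g ∘ e)^[k] l.out) =
      (∏ a, u a) * ∏ a, ∏ b, (inversionSign r r' a b : ℂ) := by
  classical
  have : Finite (InvolutionLoops e g) := Finite.of_surjective _ Quot.mk_surjective
  have := Fintype.ofFinite (InvolutionLoops e g)
  let n : InvolutionLoops e g → ℕ := fun l => Function.minimalPeriod (g ∘ e) l.out
  have hn : ∀ l, 0 < n l := fun l => minimalPeriod_pos_of_involutions he hg _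
  -- the loops are traversed once, from chosen starting points; `p i` are the ends of the pairs of
  -- `e` at which they are entered, and `σ` is the step to the next pair
  let ι := Σ l, Fin (n l)
  let p : ι → A := fun i => (g ∘ e)^[i.2] i.1.out
  let σ : Equiv.Perm ι := Equiv.Perm.sigmaCongrRight fun l => finRotate (n l)
  have hσ : ∀ i, p (σ i) = g (e (p i)) := fun i =>
    iterate_finRotate (Function.isPeriodicPt_minimalPeriod (g ∘ e) i.1.out) i.2
  have hmk_e : ∀ a, (Quot.mk _ (e a) : InvolutionLoops e g) = Quot.mk _ a := fun a =>
    (Quot.sound (r := fun a b => b = e a ∨ b = g a) (Or.inl rfl)).symm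
  have hmk_g : ∀ a, (Quot.mk _ (g a) : InvolutionLoops e g) = Quot.mk _ a := fun a =>
    (Quot.sound (r := fun a b => b = e a ∨ b = g a) (Or.inr rfl)).symm
  have hmk : ∀ i : ι, (Quot.mk _ (p i) : InvolutionLoops e g) = i.1 := by
    rintro ⟨l, k⟩
    have : ∀ k, (Quot.mk _ ((g ∘ e)^[k] l.out) : InvolutionLoops e g) = l := by
      intro k
      induction k with
      | zero => exact Quot.out_eq l
      | succ k ih =>
        rw [Function.iterate_succ_apply']
        exact (hmk_g _).trans ((hmk_e _).trans ih)
    exact this k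
  have hmke : ∀ i : ι, (Quot.mk _ (e (p i)) : InvolutionLoops e g) = i.1 := fun i =>
    (hmk_e _).trans (hmk i)
  have hpinj : p.Injective := by
    rintro ⟨l, k⟩ ⟨l', k'⟩ hkk
    obtain rfl : l = l' := (hmk ⟨l, k⟩).symm.trans ((congrArg _ hkk).trans (hmk ⟨l', k'⟩))
    have := Function.iterate_injOn_Iio_minimalPeriod (f := g ∘ e) (x := l.out) k.2 k'.2 hkk
    rw [Fin.ext this]
  have hbij : (Sum.elim p (e ∘ p)).Bijective := by
    constructor
    · refine hpinj.sumElim ((Function.LeftInverse.injective he).comp hpinj) ?_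
      intro i j hij
      obtain ⟨l, k⟩ := i
      obtain ⟨l', k'⟩ := j
      obtain rfl : l = l' := (hmk ⟨l, k⟩).symm.trans ((congrArg _ hij).trans (hmke ⟨l', k'⟩))
      exact iterate_ne_involution_iterate he he' hg hg' _ _ _ hij
    · intro a
      obtain ⟨k, hk, ha | ha⟩ := exists_iterate_of_mk_eq he hg
        (Quot.out_eq (Quot.mk _ a : InvolutionLoops e g))
      · exact ⟨.inl ⟨_, k, hk⟩, ha.symm⟩
      · exact ⟨.inr ⟨_, k, hk⟩, ha.symm⟩
  have key := prod_inversionSign hr hr' hbij σ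
    (fun i j hij => h _ _ (hpinj.ne hij.symm) fun hij' =>
      Sum.inl_ne_inr (hbij.1 (a₁ := .inl j) (a₂ := .inr i) hij'))
    (fun i j hij => by
      have := h' (e (p i)) (e (p j))
        (fun hh => hij (hpinj (Function.LeftInverse.injective he hh)).symm)
        fun hh => by
          rw [← hσ] at hh
          exact Sum.inl_ne_inr (hbij.1 (a₁ := .inl (σ i)) (a₂ := .inr j) hh.symm)
      rw [← hσ, ← hσ] at this
      rw [← this]
      simp only [Function.comp_apply]
      ring)
  -- a cycle of length `n` has the sign `(-1) ^ (n - 1)`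
  have hcard : ((-1) ^ Nat.card (InvolutionLoops e g) : ℤ) =
      (-1) ^ Fintype.card ι * (Equiv.Perm.sign σ : ℤ) := by
    rw [sign_sigmaCongrRight, Units.coe_prod, Fintype.card_sigma, ← Finset.prod_pow_eq_pow_sum,
      ← Finset.prod_mul_distrib, Nat.card_eq_fintype_card, ← Finset.card_univ, ← Finset.prod_const]
    refine Finset.prod_congr rfl fun l _ => ?_
    rw [sign_finRotate, Fintype.card_fin]
    obtain ⟨m, hm⟩ := Nat.exists_eq_succ_of_ne_zero (hn l).ne'
    simp only [hm, Nat.succ_eq_add_one, Nat.add_sub_cancel]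
    push_cast
    rw [pow_succ, mul_right_comm, ← mul_pow]
    simp
  have hcardC := congrArg (Int.cast : ℤ → ℂ) hcard
  have keyC := congrArg (Int.cast : ℤ → ℂ) key
  push_cast at hcardC keyC
  have hwprod : (∏ᶠ l : InvolutionLoops e g, ∏ k ∈ range (Function.minimalPeriod (g ∘ e) l.out),
      w ((g ∘ e)^[k] l.out)) = ∏ i, w (p i) := by
    rw [finprod_eq_prod_of_fintype, Fintype.prod_sigma]
    exact Finset.prod_congr rfl fun l _ => Finset.prod_range _
  have hx : ∏ i, x (p i) = ∏ i, x (g (e (p i))) := by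
    rw [← Equiv.prod_comp σ fun i => x (p i)]
    exact Finset.prod_congr rfl fun i _ => by rw [hσ]
  have huprod : ∏ a, u a = (∏ i, u (e (p i))) * ∏ i, u (g (e (p i))) := by
    rw [← Fintype.prod_bijective _ hbij (fun i => u (Sum.elim p (e ∘ p) i)) u fun _ => rfl,
      Fintype.prod_sum_type, mul_comm]
    simp only [Sum.elim_inl, Sum.elim_inr]
    rw [← Equiv.prod_comp σ fun i => u (p i)]
    simp only [hσ, Function.comp_apply]
  have hr'swap : ∏ i, (ordSign r' (p (σ i)) (e (p i)) : ℂ) =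
      (-1) ^ Fintype.card ι * ∏ i, (ordSign r' (e (p i)) (g (e (p i))) : ℂ) := by
    rw [← Finset.card_univ, ← Finset.prod_const, ← Finset.prod_mul_distrib]
    refine Finset.prod_congr rfl fun i _ => ?_
    rw [ordSign_swap, hσ]
    push_cast
    ring
  rw [hwprod, keyC, hcardC, Finset.prod_mul_distrib]
  simp only [Function.comp_apply]
  rw [hr'swap]
  simp only [hw, Finset.prod_mul_distrib]
  rw [hx, huprod, ← Finset.prod_mul_distrib (f := fun i => u (e (p i)))]
  have : (∏ i, x (g (e (p i)))) * ∏ i, y (e (p i)) =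
      (∏ i, (ordSign r' (e (p i)) (g (e (p i))) : ℂ)) *
        ∏ i, u (e (p i)) * u (g (e (p i))) := by
    simp only [← Finset.prod_mul_distrib, hu]
  rw [this]
  ring

/-- The product along a loop of weights `w` as in `prod_loops` depends neither on the starting point
nor on the direction: a reversal changes the sign of one factor for every pair of `e` and of one
factor for every pair of `g`, and a loop runs through as many pairs of `e` as of `g`. -/
theorem prod_loop_eq_of_mk_eq [Finite A] (he : ∀ a, e (e a) = a) (hg : ∀ a, g (g a) = a)
    {r r' : A → ℤ} {w x y u : A → ℂ} (hw : ∀ a, w a = ordSign r a (e a) * (x a * y (e a)))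
    (hu : ∀ a, x (g a) * y a = ordSign r' a (g a) * (u a * u (g a))) {a b : A}
    (hab : (Quot.mk _ a : InvolutionLoops e g) = Quot.mk _ b) :
    ∏ k ∈ range (Function.minimalPeriod (g ∘ e) a), w ((g ∘ e)^[k] a) =
      ∏ k ∈ range (Function.minimalPeriod (g ∘ e) b), w ((g ∘ e)^[k] b) := by
  let n : A → ℕ := fun a => Function.minimalPeriod (g ∘ e) a
  let Φ : A → ℂ := fun a => ∏ k ∈ range (n a), w ((g ∘ e)^[k] a)
  have hper : ∀ a, (g ∘ e)^[n a] a = a := fun a => Function.isPeriodicPt_minimalPeriod _ _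
  have hinj : (g ∘ e).Injective :=
    (Function.LeftInverse.injective hg).comp (Function.LeftInverse.injective he)
  -- the product of a function over an orbit does not change if the orbit is shifted
  have hshift : ∀ (f : A → ℂ) a, ∏ k ∈ range (n a), f (g (e ((g ∘ e)^[k] a))) =
      ∏ k ∈ range (n a), f ((g ∘ e)^[k] a) := by
    intro f a
    rw [Finset.prod_range, Finset.prod_range,
      ← Equiv.prod_comp (finRotate (n a)) fun k => f ((g ∘ e)^[k] a)]
    refine Finset.prod_congr rfl fun k _ => ?_
    rw [iterate_finRotate (hper a)]
    rfl
  -- apart from the two signs, the weights are symmetric in the ends of the pairs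
  have hΦ : ∀ a, Φ a = ∏ k ∈ range (n a), (ordSign r ((g ∘ e)^[k] a) (e ((g ∘ e)^[k] a)) *
      (ordSign r' (e ((g ∘ e)^[k] a)) (g (e ((g ∘ e)^[k] a))) *
        (u (e ((g ∘ e)^[k] a)) * u (g (e ((g ∘ e)^[k] a))))) : ℂ) := by
    intro a
    simp only [Φ, hw, ← hu]
    rw [Finset.prod_mul_distrib, Finset.prod_mul_distrib, Finset.prod_mul_distrib,
      Finset.prod_mul_distrib, hshift x]
  have hΦN : ∀ a, Φ (g (e a)) = Φ a := by
    intro a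
    have hna : n (g (e a)) = n a :=
      Function.minimalPeriod_apply (f := g ∘ e) (hinj.mem_periodicPts a)
    simp only [Φ, hna]
    rw [← hshift w a]
    refine Finset.prod_congr rfl fun k _ => ?_
    have : (g ∘ e)^[k] (g (e a)) = g (e ((g ∘ e)^[k] a)) := by
      rw [← Function.comp_apply (f := g) (g := e), ← Function.iterate_succ_apply,
        Function.iterate_succ_apply']
      rfl
    rw [this]
  -- the loop through `e a` runs backwards
  have hrev : ∀ k a, (g ∘ e)^[k] (e ((g ∘ e)^[k] a)) = e a := by
    intro k
    induction k with
    | zero => intro a; rfl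
    | succ k ih =>
      intro a
      rw [Function.iterate_succ_apply, Function.iterate_succ_apply' (n := k)]
      simp only [Function.comp_apply, he, hg]
      exact ih a
  have hΦe : ∀ a, Φ (e a) = Φ a := by
    intro a
    have hna : n (e a) = n a := by
      refine Function.minimalPeriod_eq_minimalPeriod_iff.2 fun k => ?_
      have : ∀ a, Function.IsPeriodicPt (g ∘ e) k a → Function.IsPeriodicPt (g ∘ e) k (e a) := by
        intro a h
        have h1 := hrev k a
        rwa [h.eq] at h1
      exact ⟨fun h => he a ▸ this _ h, this a⟩
    have hback : ∀ k ∈ range (n a),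
        (g ∘ e)^[n a - 1 - k] (e a) = e (g (e ((g ∘ e)^[k] a))) := by
      intro k hk
      have h1 := hrev (n a - 1 - k) (g (e ((g ∘ e)^[k] a)))
      rw [← h1]
      congr 2
      have h2 : g (e ((g ∘ e)^[k] a)) = (g ∘ e)^[k + 1] a :=
        (Function.iterate_succ_apply' (g ∘ e) k a).symm
      rw [h2, ← Function.iterate_add_apply,
        show n a - 1 - k + (k + 1) = n a by have := mem_range.1 hk; omega, hper]
    rw [hΦ, hna, ← Finset.prod_range_reflect]
    rw [Finset.prod_congr rfl fun k hk => by rw [hback k hk]]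
    simp only [he, hg]
    rw [Finset.prod_mul_distrib,
      hshift fun b => (ordSign r (e b) b : ℂ), ← Finset.prod_mul_distrib, hΦ]
    refine Finset.prod_congr rfl fun k _ => ?_
    rw [ordSign_swap r, ordSign_swap r']
    push_cast
    ring
  have hrel : ∀ b c, (c = e b ∨ c = g b) → Φ b = Φ c := by
    rintro b c (rfl | rfl)
    · exact (hΦe b).symm
    · rw [← hΦe b, ← hΦN (e b), he]
  exact congrArg (Quot.lift Φ hrel) hab

end Involutions

/-! ### The winding angle of a passage through a simplex -/

/-- The change of the argument can be computed from any continuous choice of the argument. -/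
theorem argChange_eq {r : ℝ → ℂ} {a b : ℝ} (hab : a ≤ b) (hr : ∀ t ∈ Set.Icc a b, r t ≠ 0)
    {θ : ℝ → ℝ} (hθ : ContinuousOn θ (Set.Icc a b))
    (hrθ : ∀ t ∈ Set.Icc a b, r t = ‖r t‖ * Complex.exp (θ t * Complex.I)) :
    argChange r a b = θ b - θ a := by
  have hex : ∃ θ : ℝ → ℝ, ContinuousOn θ (Set.Icc a b) ∧
      ∀ t ∈ Set.Icc a b, r t = ‖r t‖ * Complex.exp (θ t * Complex.I) := ⟨θ, hθ, hrθ⟩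
  rw [argChange, dif_pos hex]
  obtain ⟨hψ, hrψ⟩ := hex.choose_spec
  set ψ := hex.choose
  -- two choices of the argument differ by a continuous function with values in `2πℤ`
  have hmaps : Set.MapsTo (fun t => ψ t - θ t) (Set.Icc a b)
      (AddSubgroup.zmultiples (2 * Real.pi) : Set ℝ) := by
    intro t ht
    have h1 : Complex.exp (ψ t * Complex.I) = Complex.exp (θ t * Complex.I) := by
      have := (hrψ t ht).symm.trans (hrθ t ht)
      exact mul_left_cancel₀ (by simpa using hr t ht) this
    obtain ⟨n, hn⟩ := Complex.exp_eq_exp_iff_exists_int.1 h1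
    refine AddSubgroup.mem_zmultiples_iff.2 ⟨n, ?_⟩
    have h2 : ((ψ t : ℂ)) = θ t + n * (2 * Real.pi) := by
      apply mul_right_cancel₀ Complex.I_ne_zero
      rw [hn]
      ring
    have h3 : ψ t = θ t + n * (2 * Real.pi) := by exact_mod_cast h2
    simp only [h3, zsmul_eq_mul]
    ring
  have := isPreconnected_Icc.constant_of_mapsTo
    (isDiscrete_iff_discreteTopology.2 (AddSubgroup.instDiscreteTopologyZMultiples (2 * Real.pi)))
    (hψ.sub hθ) hmaps (Set.left_mem_Icc.2 hab) (Set.right_mem_Icc.2 hab)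
  simp only [Pi.sub_apply] at this
  linarith

theorem continuous_turn : Continuous turn := by unfold turn; fun_prop

theorem turn_zero : turn 0 = 0 := by norm_num [turn]

theorem turn_three : turn 3 = 1 := by norm_num [turn]

/-- The squared length of `(1 - τ, τ)`. -/
theorem turn_sq_pos (t : ℝ) : 0 < (1 - turn t) ^ 2 + turn t ^ 2 := by
  nlinarith [sq_nonneg (1 - 2 * turn t)]

theorem tangSign_mul_self (d : ℕ) (s ε : ℤˣ) (i j : ℕ) :
    tangSign d s ε i j * tangSign d s ε i j = 1 := by
  have h : ∀ u : ℤˣ, ((u : ℤ) : ℝ) * ((u : ℤ) : ℝ) = 1 := fun u => by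
    rcases Int.units_eq_one_or u with rfl | rfl <;> norm_num
  have h2 : ∀ k : ℕ, ((-1 : ℝ) ^ k) * (-1) ^ k = 1 := fun k => by rw [← mul_pow]; norm_num
  rw [tangSign]
  calc _ = (((s : ℤ) : ℝ) * ((s : ℤ) : ℝ)) * (((ε : ℤ) : ℝ) * ((ε : ℤ) : ℝ)) *
        ((-1 : ℝ) ^ (i + j + (d - 1).choose 2 + if j < i then 1 else 0) *
          (-1) ^ (i + j + (d - 1).choose 2 + if j < i then 1 else 0)) := by ring
    _ = 1 := by rw [h, h, h2]; norm_num

/-- Away from the two components `i` and `j` the shared vectors form a Vandermonde matrix, so that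
the tangent framing is a basis. -/
theorem tangFrame_isUnit {n : ℕ} (s ε : ℤˣ) {i j : ℕ} (hi : i ≤ n + 2) (hj : j ≤ n + 2)
    (hij : i ≠ j) (t : ℝ) : IsUnit (tangFrame (n + 2) s ε i j t) := by
  rw [← Matrix.vecMul_injective_iff_isUnit]
  refine (injective_iff_map_eq_zero (Matrix.vecMulLinear (tangFrame (n + 2) s ε i j t))).2 ?_
  intro v hv
  have hcol : ∀ m : Fin (n + 3),
      (∑ k : Fin (n + 1), v k.castSucc.castSucc * momentVector i j t k m) +
        v (Fin.last (n + 1)).castSucc * (tangSign (n + 2) s ε i j / (n + 2 : ℕ) *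
          (turn t * unitVector i m + (1 - turn t) * unitVector j m)) +
        v (Fin.last (n + 2)) *
          (1 / (n + 2 : ℕ) * ((1 - turn t) * unitVector i m - turn t * unitVector j m)) = 0 := by
    intro m
    have := congrFun hv m
    rw [Matrix.vecMulLinear_apply, Matrix.vecMul, dotProduct, Fin.sum_univ_castSucc,
      Fin.sum_univ_castSucc] at this
    rw [← show _ = (0 : ℝ) from this]
    congr 1
    · congr 1
      · refine Finset.sum_congr rfl fun k _ => ?_
        rw [tangFrame, Matrix.of_apply, if_pos (by simp only [Fin.val_castSucc]; omega)]
        rfl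
      · simp [tangFrame]
    · simp [tangFrame]
  -- a polynomial of degree at most `n` with `n + 1` roots
  let p : Polynomial ℝ := ∑ k : Fin (n + 1), Polynomial.monomial k (v k.castSucc.castSucc)
  let S : Finset ℕ := ((range (n + 3)).erase i).erase j
  have hS : S.card = n + 1 := by
    rw [card_erase_of_mem, card_erase_of_mem, card_range]
    · rfl
    · simp; omega
    · simp; omega
  have hinj : Function.Injective fun m : ℕ => 1 / ((m : ℝ) + 1) := by
    intro a b hab
    simpa using hab
  have hp : p = 0 := by
    refine Polynomial.eq_zero_of_natDegree_lt_card_of_eval_eq_zero' p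
      (S.image fun m : ℕ => 1 / ((m : ℝ) + 1)) ?_ ?_
    · intro x hx
      obtain ⟨m, hm, rfl⟩ := mem_image.1 hx
      simp only [S, mem_erase, mem_range] at hm
      have := hcol ⟨m, hm.2.2⟩
      simp only [unitVector, hm.1, hm.2.1, momentVector, if_false] at this
      simp only [p, Polynomial.eval_finsetSum, Polynomial.eval_monomial]
      simpa [div_pow] using this
    · rw [card_image_of_injective _ hinj, hS]
      refine Nat.lt_succ_of_le (Polynomial.natDegree_sum_le_of_forall_le _ _ fun k _ => ?_)
      exact (Polynomial.natDegree_monomial_le _).trans (Nat.lt_succ_iff.1 k.2)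
  have hv0 : ∀ k : Fin (n + 1), v k.castSucc.castSucc = 0 := by
    intro k
    have := congrArg (fun q => Polynomial.coeff q k) hp
    simp only [p, Polynomial.finsetSum_coeff, Polynomial.coeff_monomial,
      Polynomial.coeff_zero] at this
    rw [Finset.sum_eq_single k] at this
    · simpa using this
    · intro l _ hl
      simp [Fin.val_inj, hl]
    · simp
  simp only [hv0, zero_mul, Finset.sum_const_zero, zero_add] at hcol
  have e1 := hcol ⟨i, by omega⟩
  have e2 := hcol ⟨j, by omega⟩
  simp only [unitVector, hij, hij.symm, if_true, if_false] at e1 e2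
  have hD := turn_sq_pos t
  have hσ := tangSign_mul_self (n + 2) s ε i j
  set σ := tangSign (n + 2) s ε i j
  set τ := turn t
  set a := v (Fin.last (n + 1)).castSucc
  set b := v (Fin.last (n + 2))
  have hn : ((n + 2 : ℕ) : ℝ) ≠ 0 := by positivity
  have e1' : a * σ * τ + b * (1 - τ) = 0 := by
    field_simp at e1
    linear_combination e1
  have e2' : a * σ * (1 - τ) - b * τ = 0 := by
    field_simp at e2
    linear_combination e2
  have hb : b = 0 := by
    have : b * ((1 - τ) ^ 2 + τ ^ 2) = 0 := by linear_combination (1 - τ) * e1' - τ * e2'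
    exact (mul_eq_zero.1 this).resolve_right hD.ne'
  have ha : a = 0 := by
    have : a * ((1 - τ) ^ 2 + τ ^ 2) = 0 := by
      linear_combination σ * τ * e1' + σ * (1 - τ) * e2' - a * ((1 - τ) ^ 2 + τ ^ 2) * hσ
    exact (mul_eq_zero.1 this).resolve_right hD.ne'
  ext k
  refine Fin.lastCases hb (fun k => ?_) k
  exact Fin.lastCases ha hv0 k

/-- The last background vector is a combination of the last two tangent vectors alone. -/
theorem relVector_eq {n : ℕ} (s ε : ℤˣ) {i j : ℕ} (hi : i ≤ n + 2) (hj : j ≤ n + 2)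
    (hij : i ≠ j) (t : ℝ) : relVector (n + 2) s ε i j t =
      (((s : ℤ) * (-1) ^ (n + 2 + (n + 2).choose 2) * ((-1) ^ i * (1 - turn t) ^ 2 -
        (-1) ^ j * turn t ^ 2) / ((1 - turn t) ^ 2 + turn t ^ 2) : ℝ) : ℂ) +
      (((-1) ^ (n + 1).choose 2 * tangSign (n + 2) s ε i j * (s : ℤ) *
        (-1) ^ (n + 2 + (n + 2).choose 2) * (turn t * (1 - turn t)) * ((-1) ^ i + (-1) ^ j) /
        ((1 - turn t) ^ 2 + turn t ^ 2) : ℝ) : ℂ) * Complex.I := by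
  have hunit := tangFrame_isUnit s ε hi hj hij t
  have hσ := tangSign_mul_self (n + 2) s ε i j
  have hD := (turn_sq_pos t).ne'
  have hn : ((n + 2 : ℕ) : ℝ) ≠ 0 := by positivity
  set D := (1 - turn t) ^ 2 + turn t ^ 2 with hDdef
  let x : ℝ := (s : ℤ) * (-1) ^ (n + 2 + (n + 2).choose 2) * ((-1) ^ i * (1 - turn t) ^ 2 -
        (-1) ^ j * turn t ^ 2) / D
  let y : ℝ := tangSign (n + 2) s ε i j * (s : ℤ) *
        (-1) ^ (n + 2 + (n + 2).choose 2) * (turn t * (1 - turn t)) * ((-1) ^ i + (-1) ^ j) / D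
  -- the coefficients of the last background vector in the tangent framing
  let c : Fin (n + 3) → ℝ := Fin.snoc (Fin.snoc (fun _ : Fin (n + 1) => 0) y) x
  have hc : Matrix.vecMul c (tangFrame (n + 2) s ε i j t) =
      bkgdFrame (n + 2) s i j t (Fin.last (n + 2)) := by
    ext m
    rw [Matrix.vecMul, dotProduct, Fin.sum_univ_castSucc, Fin.sum_univ_castSucc]
    simp only [c, Fin.snoc_castSucc, Fin.snoc_last, zero_mul, Finset.sum_const_zero, zero_add]
    simp only [tangFrame, bkgdFrame, Matrix.of_apply, Fin.val_last, Fin.val_castSucc, lt_irrefl,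
      if_false, if_true, show ¬ (n + 2 + 1 < n + 2) by omega,
      show n + 2 + 1 ≠ n + 2 by omega]
    have hpow : ∀ k : ℕ, (-1 : ℝ) ^ (k + (n + 2) + (n + 2).choose 2) =
        (-1) ^ k * (-1) ^ (n + 2 + (n + 2).choose 2) := fun k => by rw [add_assoc, pow_add]
    have hx : x * D = (s : ℤ) * (-1) ^ (n + 2 + (n + 2).choose 2) * ((-1) ^ i * (1 - turn t) ^ 2 -
        (-1) ^ j * turn t ^ 2) := div_mul_cancel₀ _ hD
    have hy : y * D = tangSign (n + 2) s ε i j * (s : ℤ) *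
        (-1) ^ (n + 2 + (n + 2).choose 2) * (turn t * (1 - turn t)) * ((-1) ^ i + (-1) ^ j) :=
      div_mul_cancel₀ _ hD
    rw [hpow, hpow]
    generalize tangSign (n + 2) s ε i j = σ at *
    generalize (-1 : ℝ) ^ (n + 2 + (n + 2).choose 2) = q at *
    generalize (-1 : ℝ) ^ i = u at *
    generalize (-1 : ℝ) ^ j = u' at *
    generalize ((s : ℤ) : ℝ) = s at *
    generalize unitVector i m = e at *
    generalize unitVector j m = e' at *
    generalize turn t = τ at *
    clear_value x y D
    field_simp
    apply mul_left_cancel₀ hD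
    linear_combination σ * (τ * e + (1 - τ) * e') * hy + ((1 - τ) * e - τ * e') * hx +
      s * q * (τ * (1 - τ)) * (u + u') * (τ * e + (1 - τ) * e') * hσ -
      s * q * ((1 - τ) * u * e + τ * u' * e') * hDdef
  have hrow : relFrame (n + 2) s ε i j t (Fin.last (n + 2)) = c := by
    rw [relFrame, Matrix.mul_apply_eq_vecMul, ← hc, Matrix.vecMul_vecMul,
      Matrix.mul_nonsing_inv _ ((Matrix.isUnit_iff_isUnit_det _).1 hunit), Matrix.vecMul_one]
  have h1 : (⟨n + 2 - 1, by omega⟩ : Fin (n + 2 + 1)) = (Fin.last (n + 1)).castSucc := rfl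
  rw [relVector, hrow, h1]
  simp only [c, Fin.snoc_castSucc, Fin.snoc_last, x, y]
  push_cast
  ring

theorem argChange_of_cos_sin {r : ℝ → ℂ} {a b : ℝ} (hab : a ≤ b) {θ : ℝ → ℝ} (hθ : Continuous θ)
    (hr : ∀ t, r t = (Real.cos (θ t) : ℂ) + (Real.sin (θ t) : ℂ) * Complex.I) :
    argChange r a b = θ b - θ a := by
  have h : ∀ t, r t = Complex.exp (θ t * Complex.I) := fun t => by
    rw [hr, Complex.exp_mul_I, Complex.ofReal_cos, Complex.ofReal_sin]
  refine argChange_eq hab (fun t _ => by rw [h]; exact Complex.exp_ne_zero _) hθ.continuousOn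
    fun t _ => ?_
  rw [h, Complex.norm_exp_ofReal_mul_I, Complex.ofReal_one, one_mul]

theorem exists_angle_of_sign (s : ℤˣ) (k l : ℕ) :
    ∃ c : ℝ, Real.cos c = (s : ℤ) * (-1) ^ k * (-1) ^ l ∧ Real.sin c = 0 := by
  have : ((s : ℤ) : ℝ) * (-1) ^ k * (-1) ^ l = 1 ∨ ((s : ℤ) : ℝ) * (-1) ^ k * (-1) ^ l = -1 := by
    rcases Int.units_eq_one_or s with rfl | rfl <;>
      rcases neg_one_pow_eq_or ℝ k with h | h <;>
      rcases neg_one_pow_eq_or ℝ l with h' | h' <;> simp [h, h']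
  rcases this with h | h
  · exact ⟨0, by rw [h, Real.cos_zero], Real.sin_zero⟩
  · exact ⟨Real.pi, by rw [h, Real.cos_pi], Real.sin_pi⟩

/-- Between half-edges of different parity the background framing does not wind. -/
theorem winding_of_odd {d : ℕ} (hd : 2 ≤ d) (s ε : ℤˣ) {i j : ℕ} (hi : i ≤ d) (hj : j ≤ d)
    (hij : Odd (i + j)) : winding d s ε i j = 0 := by
  obtain ⟨n, rfl⟩ := Nat.exists_eq_add_of_le' hd
  have hne : i ≠ j := by rintro rfl; exact (Nat.not_odd_iff_even.2 (Even.add_self i)) hij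
  have hji : (-1 : ℝ) ^ j = -(-1) ^ i := by
    have h1 : (-1 : ℝ) ^ (i + j) = _ := hij.neg_one_pow
    rw [pow_add] at h1
    have h2 : (-1 : ℝ) ^ i * (-1) ^ i = 1 := by rw [← mul_pow]; norm_num
    linear_combination (-1 : ℝ) ^ i * h1 - (-1) ^ j * h2
  obtain ⟨c, hc, hs⟩ := exists_angle_of_sign s (n + 2 + (n + 2).choose 2) i
  rw [winding, argChange_of_cos_sin (θ := fun _ => c) (by norm_num) continuous_const, sub_self]
  intro t
  have hD := (turn_sq_pos t).ne'
  rw [relVector_eq s ε hi hj hne, hji, hs, hc]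
  refine congrArg₂ _ (congrArg Complex.ofReal ?_)
    (congrArg (fun y : ℝ => (y : ℂ) * Complex.I) ?_)
  · field_simp
    ring
  · ring

/-- Between half-edges of equal parity the background framing makes a half turn. -/
theorem winding_of_even {d : ℕ} (hd : 2 ≤ d) (s ε : ℤˣ) {i j : ℕ} (hi : i ≤ d) (hj : j ≤ d)
    (hne : i ≠ j) (hij : Even (i + j)) :
    winding d s ε i j = (s : ℤ) * (ε : ℤ) * (if j < i then -1 else 1) * Real.pi := by
  obtain ⟨n, rfl⟩ := Nat.exists_eq_add_of_le' hd
  have hji : (-1 : ℝ) ^ j = (-1) ^ i := by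
    have h1 : (-1 : ℝ) ^ (i + j) = _ := hij.neg_one_pow
    rw [pow_add] at h1
    have h2 : (-1 : ℝ) ^ i * (-1) ^ i = 1 := by rw [← mul_pow]; norm_num
    linear_combination (-1 : ℝ) ^ i * h1 - (-1) ^ j * h2
  obtain ⟨c, hc, hs⟩ := exists_angle_of_sign s (n + 2 + (n + 2).choose 2) i
  have hκ : (-1 : ℝ) ^ (n + 1).choose 2 * tangSign (n + 2) s ε i j =
      (s : ℤ) * (ε : ℤ) * (if j < i then -1 else 1) := by
    have h2 : (-1 : ℝ) ^ (n + 1).choose 2 * (-1) ^ (n + 1).choose 2 = 1 := by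
      rw [← mul_pow]; norm_num
    rw [tangSign, pow_add, pow_add, hij.neg_one_pow, show n + 2 - 1 = n + 1 from rfl]
    split_ifs
    · linear_combination -(((s : ℤ) : ℝ) * (ε : ℤ)) * h2
    · linear_combination (((s : ℤ) : ℝ) * (ε : ℤ)) * h2
  have hκ1 : ((s : ℤ) : ℝ) * (ε : ℤ) * (if j < i then -1 else 1) = 1 ∨
      ((s : ℤ) : ℝ) * (ε : ℤ) * (if j < i then -1 else 1) = -1 := by
    rcases Int.units_eq_one_or s with rfl | rfl <;> rcases Int.units_eq_one_or ε with rfl | rfl <;>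
      split_ifs <;> simp
  set κ : ℝ := (s : ℤ) * (ε : ℤ) * (if j < i then -1 else 1)
  -- the last background vector turns by twice the angle of `(1 - τ, τ)`
  let z : ℝ → ℂ := fun t => ⟨1 - turn t, turn t⟩
  have hz : Continuous fun t => Complex.arg (z t) := by
    refine continuous_iff_continuousAt.2 fun t => ?_
    refine (Complex.continuousAt_arg ?_).comp ?_
    · rw [Complex.mem_slitPlane_iff]
      by_cases h : turn t = 0
      · left; simp [z, h]
      · right; exact h
    · have : z = fun t => ((1 - turn t : ℝ) : ℂ) + (turn t : ℝ) * Complex.I := by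
        ext t
        exact Complex.mk_eq_add_mul_I _ _
      rw [this]
      have := continuous_turn
      fun_prop
  rw [winding, argChange_of_cos_sin (θ := fun t => c + 2 * (κ * Complex.arg (z t))) (by norm_num)
    (by fun_prop)]
  · have h0 : z 0 = 1 := by simp [z, turn_zero, Complex.ext_iff]
    have h3 : z 3 = Complex.I := by simp [z, turn_three, Complex.ext_iff]
    simp only [h0, h3, Complex.arg_one, Complex.arg_I]
    ring
  · intro t
    have hD := (turn_sq_pos t).ne'
    have hcos : ‖z t‖ * Real.cos (Complex.arg (z t)) = 1 - turn t := Complex.norm_mul_cos_arg _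
    have hsin : ‖z t‖ * Real.sin (Complex.arg (z t)) = turn t := Complex.norm_mul_sin_arg _
    have hnorm : ‖z t‖ ^ 2 = (1 - turn t) ^ 2 + turn t ^ 2 := by
      rw [Complex.sq_norm, Complex.normSq_apply]
      simp only [z]
      ring
    have h1 : Real.cos (κ * Complex.arg (z t)) = Real.cos (Complex.arg (z t)) := by
      rcases hκ1 with h | h <;> simp [h]
    have h2 : Real.sin (κ * Complex.arg (z t)) = κ * Real.sin (Complex.arg (z t)) := by
      rcases hκ1 with h | h <;> simp [h]
    have hκκ : κ * κ = 1 := by rcases hκ1 with h | h <;> simp [h]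
    rw [relVector_eq s ε hi hj hne, hji, hκ, Real.cos_add, Real.sin_add, hs, hc, Real.cos_two_mul',
      Real.sin_two_mul, h1, h2]
    generalize Real.cos (Complex.arg (z t)) = C at *
    generalize Real.sin (Complex.arg (z t)) = S at *
    generalize (-1 : ℝ) ^ (n + 2 + (n + 2).choose 2) = q
    generalize (-1 : ℝ) ^ i = u
    generalize turn t = τ at *
    have hC : C ^ 2 = (1 - τ) ^ 2 / ((1 - τ) ^ 2 + τ ^ 2) := by
      rw [eq_div_iff hD, ← hnorm, ← hcos]
      ring
    have hS : S ^ 2 = τ ^ 2 / ((1 - τ) ^ 2 + τ ^ 2) := by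
      rw [eq_div_iff hD, ← hnorm]
      linear_combination (‖z t‖ * S + τ) * hsin
    have hSC : S * C = τ * (1 - τ) / ((1 - τ) ^ 2 + τ ^ 2) := by
      rw [eq_div_iff hD, ← hnorm]
      linear_combination (‖z t‖ * C) * hsin + τ * hcos
    refine congrArg₂ _ (congrArg Complex.ofReal ?_)
      (congrArg (fun y : ℝ => (y : ℂ) * Complex.I) ?_)
    · linear_combination (-((s : ℤ) : ℝ) * q * u) * (hC - hS) +
        (((s : ℤ) : ℝ) * q * u * S ^ 2) * hκκ
    · linear_combination (-2 * ((s : ℤ) : ℝ) * q * u * κ) * hSC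

/-! ### Winding matrices act on two row states by scalars -/

/-- The rows of blocks on which the winding matrices act from the right by scalars. The first one
reads off the upper left entry of `O_same + O_opposite`; the second one is its image, up to a
factor, both under a half turn inside a simplex and under a crossing of `w₁`. -/
def stateRow (u : ℤˣ) : Fin 2 → Matrix (Fin 2) (Fin 2) ℂ :=
  if u = 1 then ![!![1, 0; 0, 0], !![1, 0; 0, 0]] else ![!![0, -1; 0, 0], !![0, 1; 0, 0]]

/-- The scalar by which the passage `î → ĵ` through a simplex with label `s` acts. -/
def passWeight (s : ℤˣ) (i j : ℕ) : ℂ :=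
  if Even (i + j) then -Complex.I * ((s : ℤ) * if j < i then -1 else 1) else 1

theorem liftX_zero : liftX 0 = 1 := by simp [liftX]

theorem liftX_pi {k : ℝ} (hk : k = 1 ∨ k = -1) :
    liftX (k * Real.pi) = !![0, Complex.I * k; Complex.I * k, 0] := by
  have hc : Real.cos (k * Real.pi / 2) = 0 := by
    rcases hk with rfl | rfl
    · rw [one_mul, Real.cos_pi_div_two]
    · rw [neg_one_mul, neg_div, Real.cos_neg, Real.cos_pi_div_two]
  have hs : Real.sin (k * Real.pi / 2) = k := by
    rcases hk with rfl | rfl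
    · rw [one_mul, Real.sin_pi_div_two]
    · rw [neg_one_mul, neg_div, Real.sin_neg, Real.sin_pi_div_two]
  rw [liftX, hc, hs]
  ext a b
  fin_cases a <;> fin_cases b <;> simp [pauliX]

/-- A passage between legs of equal parity exchanges the two rows, up to a scalar; a passage between
legs of different parity acts trivially. -/
theorem stateRow_vecMul_simplexMatrix {d : ℕ} (hd : 2 ≤ d) (s u : ℤˣ) {i j : ℕ} (hi : i ≤ d)
    (hj : j ≤ d) (hij : i ≠ j) :
    Matrix.vecMul (stateRow u) (simplexMatrix d s i j) =
      passWeight s i j • stateRow (u * (-1) ^ (i + j + 1)) := by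
  rcases Nat.even_or_odd (i + j) with h | h
  · have hs : ∀ ε : ℤˣ, ((s : ℤ) : ℝ) * (ε : ℤ) * (if j < i then -1 else 1) = 1 ∨
        ((s : ℤ) : ℝ) * (ε : ℤ) * (if j < i then -1 else 1) = -1 := fun ε => by
      rcases Int.units_eq_one_or s with rfl | rfl <;>
        rcases Int.units_eq_one_or ε with rfl | rfl <;> split_ifs <;> simp
    rw [simplexMatrix, winding_of_even hd s _ hi hj hij h, winding_of_even hd s _ hi hj hij h,
      liftX_pi (hs 1), liftX_pi (hs (-1)), passWeight, if_pos h, Odd.neg_one_pow h.add_one,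
      mul_neg_one]
    rcases Int.units_eq_one_or s with rfl | rfl <;>
      rcases Int.units_eq_one_or u with rfl | rfl <;> split_ifs <;>
      (ext a b c
       fin_cases a <;> fin_cases b <;> fin_cases c <;>
        simp [stateRow, Matrix.vecMul, dotProduct, Fin.sum_univ_two])
  · rw [simplexMatrix, winding_of_odd hd s _ hi hj h, winding_of_odd hd s _ hi hj h, liftX_zero,
      passWeight, if_neg (Nat.not_even_iff_odd.2 h), Even.neg_one_pow h.add_one, mul_one, one_smul]
    have : (!![1, 0; 0, 1] : WindingMatrix) = 1 := Matrix.one_fin_two.symm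
    rw [this, Matrix.vecMul_one]

theorem stateRow_vecMul_crossMatrix (c u : ℤˣ) :
    Matrix.vecMul (stateRow u) (crossMatrix c) = ((c : ℤ) : ℂ) • stateRow (-u) := by
  rcases Int.units_eq_one_or c with rfl | rfl <;> rcases Int.units_eq_one_or u with rfl | rfl <;>
  (ext a b c
   fin_cases a <;> fin_cases b <;> fin_cases c <;>
    simp [stateRow, crossMatrix, pauliY, Matrix.vecMul, dotProduct, Fin.sum_univ_two])

theorem vecMul_smul_row (c : ℂ) (v : Fin 2 → Matrix (Fin 2) (Fin 2) ℂ) (W : WindingMatrix) :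
    Matrix.vecMul (c • v) W = c • Matrix.vecMul v W := by
  ext1 a
  simp [Matrix.vecMul, dotProduct]

/-- If every matrix of a sequence acts on the state rows by a scalar and by a change of the row that
is the quotient of two consecutive signs `p`, then so does a product, with the first and the last
sign. -/
theorem stateRow_vecMul_prod {W : ℕ → WindingMatrix} {w : ℕ → ℂ} {p : ℕ → ℤˣ}
    (h : ∀ k u, Matrix.vecMul (stateRow u) (W k) = w k • stateRow (u * (p k * p (k + 1)))) (n : ℕ) :
    Matrix.vecMul (stateRow (p n * p 0)) ((List.range n).map W).reverse.prod =
      (∏ k ∈ range n, w k) • stateRow 1 := by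
  induction n with
  | zero => simp
  | succ n ih =>
    rw [List.range_succ, List.map_append, List.reverse_append, List.prod_append, List.map_singleton,
      List.reverse_singleton, List.prod_singleton, ← Matrix.vecMul_vecMul, h, vecMul_smul_row,
      show p (n + 1) * p 0 * (p n * p (n + 1)) = p n * p 0 by
        rw [mul_mul_mul_comm, mul_comm (p (n + 1)), mul_assoc, mul_comm (p 0),
          ← mul_assoc (p (n + 1)),
          Int.units_mul_self, one_mul], ih, smul_smul, Finset.prod_range_succ, mul_comm]

/-- Around a closed loop the upper left entry of `O_same + O_opposite` is the product of the
scalars. -/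
theorem upperLeft_prod {W : ℕ → WindingMatrix} {w : ℕ → ℂ} {p : ℕ → ℤˣ}
    (h : ∀ k u, Matrix.vecMul (stateRow u) (W k) = w k • stateRow (u * (p k * p (k + 1)))) {n : ℕ}
    (hn : p n = p 0) :
    (((List.range n).map W).reverse.prod 0 0 + ((List.range n).map W).reverse.prod 1 0) 0 0 =
      ∏ k ∈ range n, w k := by
  have := congrFun (congrFun (congrFun (stateRow_vecMul_prod h n) 0) 0) 0
  rw [hn, Int.units_mul_self] at this
  simpa [stateRow, Matrix.vecMul, dotProduct, Fin.sum_univ_two, Matrix.mul_apply] using this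

/-! ### Strands of a trivalent resolution -/

namespace PlaneTree

variable {S : ℕ → Prop}

theorem mem_of_openEnd : ∀ {t : PlaneTree} {a : ℕ}, t.openEnd S = some a → a ∈ t.leaves ∧ S a
  | leaf i, a, h => by
    by_cases hi : S i
    · obtain rfl : i = a := by simpa [openEnd, hi] using h
      exact ⟨by simp [leaves], hi⟩
    · simp [openEnd, hi] at h
  | node l r, a, h => by
    rw [leaves, List.mem_append]
    rcases hl : l.openEnd S with _ | b <;> rcases hr : r.openEnd S with _ | c <;>
      simp only [openEnd, hl, hr, Option.some.injEq, reduceCtorEq] at h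
    · subst h
      exact ⟨Or.inr (mem_of_openEnd hr).1, (mem_of_openEnd hr).2⟩
    · subst h
      exact ⟨Or.inl (mem_of_openEnd hl).1, (mem_of_openEnd hl).2⟩

theorem openEnd_node {l r : PlaneTree} {a : ℕ} (h : (node l r).openEnd S = some a) :
    (l.openEnd S = some a ∧ r.openEnd S = none) ∨ (l.openEnd S = none ∧ r.openEnd S = some a) := by
  rcases hl : l.openEnd S with _ | b <;> rcases hr : r.openEnd S with _ | c <;>
    simp_all [openEnd]

theorem Joined.symm : ∀ {t : PlaneTree} {a b : ℕ}, t.Joined S a b → t.Joined S b a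
  | leaf _, _, _, h => h
  | node _ _, _, _, h => by
    rcases h with h | h | h | h
    · exact Or.inl (Joined.symm h)
    · exact Or.inr (Or.inl (Joined.symm h))
    · exact Or.inr (Or.inr (Or.inr h))
    · exact Or.inr (Or.inr (Or.inl h))

theorem Joined.mem : ∀ {t : PlaneTree} {a b : ℕ}, t.Joined S a b → a ∈ t.leaves ∧ S a
  | leaf _, _, _, h => h.elim
  | node _ _, _, _, h => by
    rw [leaves, List.mem_append]
    rcases h with h | h | h | h
    · exact ⟨Or.inl (Joined.mem h).1, (Joined.mem h).2⟩
    · exact ⟨Or.inr (Joined.mem h).1, (Joined.mem h).2⟩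
    · exact ⟨Or.inl (mem_of_openEnd h.1).1, (mem_of_openEnd h.1).2⟩
    · exact ⟨Or.inr (mem_of_openEnd h.2).1, (mem_of_openEnd h.2).2⟩

/-- Every strand either ends at another leaf or leaves the tree through the root. -/
theorem exists_joined_or_openEnd : ∀ {t : PlaneTree} {a : ℕ}, a ∈ t.leaves → S a →
    t.openEnd S = some a ∨ ∃ b, t.Joined S a b
  | leaf i, a, h, hS => by
    obtain rfl : a = i := by simpa [leaves] using h
    simp [openEnd, hS]
  | node l r, a, h, hS => by
    rw [leaves, List.mem_append] at h
    rcases h with h | h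
    · rcases exists_joined_or_openEnd h hS with ha | ⟨b, hb⟩
      · rcases hr : r.openEnd S with _ | c
        · left; simp [openEnd, ha, hr]
        · exact Or.inr ⟨c, Or.inr (Or.inr (Or.inl ⟨ha, hr⟩))⟩
      · exact Or.inr ⟨b, Or.inl hb⟩
    · rcases exists_joined_or_openEnd h hS with ha | ⟨b, hb⟩
      · rcases hl : l.openEnd S with _ | c
        · left; simp [openEnd, ha, hl]
        · exact Or.inr ⟨c, Or.inr (Or.inr (Or.inr ⟨hl, ha⟩))⟩
      · exact Or.inr ⟨b, Or.inr (Or.inl hb)⟩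

/-- A strand that leaves the tree through the root does not end at a leaf. -/
theorem not_joined_of_openEnd : ∀ {t : PlaneTree}, t.leaves.Nodup → ∀ {a b : ℕ},
    t.openEnd S = some a → ¬ t.Joined S a b
  | leaf _, _, _, _, _ => fun h => h.elim
  | node l r, hn, a, b, h => by
    rw [leaves, List.nodup_append] at hn
    obtain ⟨hl, hr, hd⟩ := hn
    have hdis : ∀ x, x ∈ l.leaves → x ∈ r.leaves → False := fun x h1 h2 => hd x h1 x h2 rfl
    rcases openEnd_node h with ⟨h1, h2⟩ | ⟨h1, h2⟩ <;> rintro (h | h | h | h)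
    · exact not_joined_of_openEnd hl h1 h
    · exact hdis a (mem_of_openEnd h1).1 h.mem.1
    · simp [h2] at h
    · simp [h2] at h
    · exact hdis a h.mem.1 (mem_of_openEnd h2).1
    · exact not_joined_of_openEnd hr h2 h
    · simp [h1] at h
    · simp [h1] at h

theorem Joined.ne : ∀ {t : PlaneTree}, t.leaves.Nodup → ∀ {a b : ℕ}, t.Joined S a b → a ≠ b
  | leaf _, _, _, _, h => h.elim
  | node l r, hn, a, b, h => by
    rw [leaves, List.nodup_append] at hn
    obtain ⟨hl, hr, hd⟩ := hn
    rcases h with h | h | h | h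
    · exact h.ne hl
    · exact h.ne hr
    · exact hd a (mem_of_openEnd h.1).1 b (mem_of_openEnd h.2).1
    · exact (hd b (mem_of_openEnd h.1).1 a (mem_of_openEnd h.2).1).symm

theorem Joined.unique : ∀ {t : PlaneTree}, t.leaves.Nodup → ∀ {a b c : ℕ},
    t.Joined S a b → t.Joined S a c → b = c
  | leaf _, _, _, _, _, h, _ => h.elim
  | node l r, hn, a, b, c, h, h' => by
    rw [leaves, List.nodup_append] at hn
    obtain ⟨hl, hr, hd⟩ := hn
    have hdis : ∀ x, x ∈ l.leaves → x ∈ r.leaves → False := fun x h1 h2 => hd x h1 x h2 rfl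
    rcases h with h | h | h | h <;> rcases h' with h' | h' | h' | h'
    · exact h.unique hl h'
    · exact (hdis a h.mem.1 h'.mem.1).elim
    · exact (not_joined_of_openEnd hl h'.1 h).elim
    · exact (hdis a h.mem.1 (mem_of_openEnd h'.2).1).elim
    · exact (hdis a h'.mem.1 h.mem.1).elim
    · exact h.unique hr h'
    · exact (hdis a (mem_of_openEnd h'.1).1 h.mem.1).elim
    · exact (not_joined_of_openEnd hr h'.2 h).elim
    · exact (not_joined_of_openEnd hl h.1 h').elim
    · exact (hdis a (mem_of_openEnd h.1).1 h'.mem.1).elim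
    · exact Option.some.inj (h.2.symm.trans h'.2)
    · exact (hdis a (mem_of_openEnd h.1).1 (mem_of_openEnd h'.2).1).elim
    · exact (hdis a h'.mem.1 (mem_of_openEnd h.2).1).elim
    · exact (not_joined_of_openEnd hr h.2 h').elim
    · exact (hdis a (mem_of_openEnd h'.1).1 (mem_of_openEnd h.2).1).elim
    · exact Option.some.inj (h.1.symm.trans h'.1)

open scoped Classical in
/-- A strand leaves the tree through the root if and only if the number of used leaves is odd. -/
theorem sum_leaves : ∀ t : PlaneTree, (t.leaves.map fun i => if S i then (1 : ZMod 2) else 0).sum =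
    if (t.openEnd S).isSome then 1 else 0
  | leaf i => by
    by_cases h : S i <;> simp [leaves, openEnd, h]
  | node l r => by
    rw [leaves, List.map_append, List.sum_append, sum_leaves l, sum_leaves r]
    rcases hl : l.openEnd S with _ | b <;> rcases hr : r.openEnd S with _ | c <;>
      simp [openEnd, hl, hr]
    decide

section Noncrossing

variable {K : ℕ → ℕ → ℤ}

/-- The root is not enclosed by a strand that joins two leaves. -/
theorem Joined.sign_openEnd (hK : ∀ a b, K a b = -K b a) : ∀ {t : PlaneTree},
    t.leaves.Pairwise (fun a b => K a b = 1) → ∀ {a b c : ℕ},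
    t.Joined S a b → t.openEnd S = some c → K a c * K b c = 1
  | leaf _, _, _, _, _, h, _ => h.elim
  | node l r, hn, a, b, c, h, hc => by
    rw [leaves, List.pairwise_append] at hn
    obtain ⟨hl, hr, hd⟩ := hn
    rcases openEnd_node hc with ⟨h1, h2⟩ | ⟨h1, h2⟩ <;> rcases h with h | h | h | h
    · exact Joined.sign_openEnd hK hl h h1
    · rw [hK a, hK b, hd _ (mem_of_openEnd h1).1 _ h.mem.1,
        hd _ (mem_of_openEnd h1).1 _ h.symm.mem.1]
      rfl
    · simp [h2] at h
    · simp [h2] at h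
    · rw [hd _ h.mem.1 _ (mem_of_openEnd h2).1, hd _ h.symm.mem.1 _ (mem_of_openEnd h2).1]
      rfl
    · exact Joined.sign_openEnd hK hr h h2
    · simp [h1] at h
    · simp [h1] at h

/-- Two strands in a plane tree do not cross. -/
theorem Joined.sign_joined (hK : ∀ a b, K a b = -K b a) : ∀ {t : PlaneTree},
    t.leaves.Pairwise (fun a b => K a b = 1) → ∀ {a b c e : ℕ},
    t.Joined S a b → t.Joined S c e → c ≠ a → c ≠ b → K a c * K a e * K b c * K b e = 1
  | leaf _, _, _, _, _, _, h, _, _, _ => h.elim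
  | node l r, hn, a, b, c, e, h, h', hca, hcb => by
    rw [leaves, List.pairwise_append] at hn
    obtain ⟨hl, hr, hd⟩ := hn
    -- two strands in different branches
    have key0 : ∀ {a b c e}, l.Joined S a b → r.Joined S c e →
        K a c * K a e * K b c * K b e = 1 := fun h h' => by
      rw [hd _ h.mem.1 _ h'.mem.1, hd _ h.mem.1 _ h'.symm.mem.1, hd _ h.symm.mem.1 _ h'.mem.1,
        hd _ h.symm.mem.1 _ h'.symm.mem.1]
      rfl
    -- a strand inside one of the two branches and the strand that joins the branches
    have key1 : ∀ {a b c e}, l.Joined S a b → l.openEnd S = some c → r.openEnd S = some e →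
        K a c * K b c = 1 ∧ K a e * K b e = 1 := fun h h1 h2 => by
      refine ⟨Joined.sign_openEnd hK hl h h1, ?_⟩
      rw [hd _ h.mem.1 _ (mem_of_openEnd h2).1, hd _ h.symm.mem.1 _ (mem_of_openEnd h2).1]
      rfl
    have key2 : ∀ {a b c e}, r.Joined S a b → l.openEnd S = some c → r.openEnd S = some e →
        K a c * K b c = 1 ∧ K a e * K b e = 1 := fun {a b c e} h h1 h2 => by
      refine ⟨?_, Joined.sign_openEnd hK hr h h2⟩
      rw [hK a, hK b, hd _ (mem_of_openEnd h1).1 _ h.mem.1,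
        hd _ (mem_of_openEnd h1).1 _ h.symm.mem.1]
      rfl
    have swap : ∀ {a b c e}, K c a * K e a = 1 ∧ K c b * K e b = 1 →
        K a c * K a e * K b c * K b e = 1 := fun {a b c e} h => by
      rw [hK a c, hK a e, hK b c, hK b e]
      linear_combination h.1 * (K c b * K e b) + h.2
    have noswap : ∀ {a b c e}, K a c * K b c = 1 ∧ K a e * K b e = 1 →
        K a c * K a e * K b c * K b e = 1 := fun {a b c e} h => by
      linear_combination h.1 * (K a e * K b e) + h.2
    rcases h with h | h | h | h <;> rcases h' with h' | h' | h' | h'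
    · exact Joined.sign_joined hK hl h h' hca hcb
    · exact key0 h h'
    · exact noswap (key1 h h'.1 h'.2)
    · exact noswap (key1 h h'.1 h'.2).symm
    · rw [hK a c, hK a e, hK b c, hK b e]
      linear_combination key0 h' h
    · exact Joined.sign_joined hK hr h h' hca hcb
    · exact noswap (key2 h h'.1 h'.2)
    · exact noswap (key2 h h'.1 h'.2).symm
    · exact swap (key1 h' h.1 h.2)
    · exact swap (key2 h' h.1 h.2)
    · exact (hca (Option.some.inj (h'.1.symm.trans h.1))).elim
    · exact (hcb (Option.some.inj (h'.2.symm.trans h.2))).elim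
    · exact swap (key1 h' h.1 h.2).symm
    · exact swap (key2 h' h.1 h.2).symm
    · exact (hcb (Option.some.inj (h'.1.symm.trans h.1))).elim
    · exact (hca (Option.some.inj (h'.2.symm.trans h.2))).elim

end Noncrossing

end PlaneTree

/-- A rank of the half-edge `î` in the order `0̂, 2̂, 4̂, …, 1̂, 3̂, 5̂, …`: the odd indices are
moved behind the even ones. -/
def legRank (d i : ℕ) : ℤ := (i % 2 : ℕ) * (d + 1) + i

theorem ordSign_legRank_of_even {d i j : ℕ} (hij : i ≠ j)
    (h : Even (i + j)) : ordSign (legRank d) i j = if j < i then -1 else 1 := by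
  have h2 : i % 2 = j % 2 := by have := Nat.even_iff.1 h; omega
  rw [ordSign, legRank, legRank, h2]
  split_ifs with hji
  · exact Int.sign_eq_neg_one_of_neg (by omega)
  · exact Int.sign_eq_one_of_pos (by omega)

theorem ordSign_legRank_of_odd {d i j : ℕ} (hi : i ≤ d) (hj : j ≤ d)
    (h : Odd (i + j)) : ordSign (legRank d) i j = if Even i then 1 else -1 := by
  have h1 := Nat.odd_iff.1 h
  rw [ordSign, legRank, legRank]
  split_ifs with hi2
  · have h2 := Nat.even_iff.1 hi2
    have h3 : j % 2 = 1 := by omega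
    rw [h2, h3]
    exact Int.sign_eq_one_of_pos (by omega)
  · have h2 := Nat.odd_iff.1 (Nat.not_even_iff_odd.1 hi2)
    have h3 : j % 2 = 0 := by omega
    rw [h2, h3]
    exact Int.sign_eq_neg_one_of_neg (by omega)

theorem legRank_injective {d i j : ℕ} (hi : i ≤ d) (hj : j ≤ d) (h : legRank d i = legRank d j) :
    i = j := by
  have h3 : ordSign (legRank d) i j = 0 := by rw [ordSign, h, sub_self, Int.sign_zero]
  by_contra hij
  rcases Nat.even_or_odd (i + j) with h1 | h1
  · rw [ordSign_legRank_of_even hij h1] at h3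
    split_ifs at h3; simp at h3
  · rw [ordSign_legRank_of_odd hi hj h1] at h3
    split_ifs at h3; simp at h3

theorem PlaneTree.mem_legs {d i : ℕ} : i ∈ PlaneTree.legs d ↔ i ≠ 0 ∧ i ≤ d := by
  simp only [PlaneTree.legs, List.mem_append, List.mem_filter, List.mem_range, decide_eq_true_eq]
  omega

theorem PlaneTree.legs_pairwise (d : ℕ) :
    (PlaneTree.legs d).Pairwise fun a b => ordSign (legRank d) a b = 1 := by
  have hsub : ∀ (p : ℕ → Bool) (c : ℕ), (∀ i, p i = true → i % 2 = c) →
      ((List.range (d + 1)).filter p).Pairwise fun a b => ordSign (legRank d) a b = 1 := by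
    intro p c hp
    refine List.Pairwise.imp_of_mem (R := fun a b => a < b) ?_ (List.pairwise_lt_range.filter p)
    intro a b ha hb hab
    rw [List.mem_filter, List.mem_range] at ha hb
    rw [ordSign_legRank_of_even hab.ne, if_neg hab.not_gt]
    rw [Nat.even_iff]
    have := hp a ha.2
    have := hp b hb.2
    omega
  rw [PlaneTree.legs, List.pairwise_append]
  refine ⟨hsub _ 0 fun i hi => ?_, hsub _ 1 fun i hi => ?_, ?_⟩
  · simp only [decide_eq_true_eq] at hi
    exact hi.2
  · simpa using hi
  · intro a ha b hb
    simp only [List.mem_filter, List.mem_range, decide_eq_true_eq] at ha hb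
    rw [ordSign_legRank_of_odd (by omega) (by omega), if_pos (Nat.even_iff.2 ha.2.2)]
    rw [Nat.odd_iff]
    omega

theorem PlaneTree.legs_nodup (d : ℕ) : (PlaneTree.legs d).Nodup :=
  (PlaneTree.legs_pairwise d).imp fun {a b} h hab => by
    rw [hab, ordSign, sub_self, Int.sign_zero] at h
    exact zero_ne_one h

namespace Resolution

variable {d : ℕ} (R : Resolution d) {S : ℕ → Prop}

theorem nodup : R.tree.leaves.Nodup := R.leaves_eq ▸ PlaneTree.legs_nodup d

theorem ne_zero_of_mem {a : ℕ} (h : a ∈ R.tree.leaves) : a ≠ 0 :=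
  (PlaneTree.mem_legs.1 (R.leaves_eq ▸ h)).1

theorem le_of_mem {a : ℕ} (h : a ∈ R.tree.leaves) : a ≤ d :=
  (PlaneTree.mem_legs.1 (R.leaves_eq ▸ h)).2

variable {R}

theorem Joined.symm {a b : ℕ} (h : R.Joined S a b) : R.Joined S b a := by
  rcases h with h | ⟨h0, h | h⟩
  · exact Or.inl h.symm
  · exact Or.inr ⟨h0, Or.inr h⟩
  · exact Or.inr ⟨h0, Or.inl h⟩

theorem Joined.mem {a b : ℕ} (h : R.Joined S a b) : S a ∧ a ≤ d := by
  rcases h with h | ⟨h0, ⟨rfl, h⟩ | ⟨rfl, h⟩⟩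
  · exact ⟨h.mem.2, R.le_of_mem h.mem.1⟩
  · exact ⟨h0, Nat.zero_le _⟩
  · exact ⟨(PlaneTree.mem_of_openEnd h).2, R.le_of_mem (PlaneTree.mem_of_openEnd h).1⟩

theorem Joined.ne {a b : ℕ} (h : R.Joined S a b) : a ≠ b := by
  rcases h with h | ⟨h0, ⟨rfl, h⟩ | ⟨rfl, h⟩⟩
  · exact h.ne R.nodup
  · exact (R.ne_zero_of_mem (PlaneTree.mem_of_openEnd h).1).symm
  · exact R.ne_zero_of_mem (PlaneTree.mem_of_openEnd h).1

theorem Joined.unique {a b c : ℕ} (h : R.Joined S a b) (h' : R.Joined S a c) : b = c := by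
  rcases h with h | ⟨h0, ⟨rfl, h⟩ | ⟨rfl, h⟩⟩ <;>
    rcases h' with h' | ⟨h0', ⟨e, h'⟩ | ⟨rfl, h'⟩⟩
  · exact h.unique R.nodup h'
  · exact (R.ne_zero_of_mem h.mem.1 e).elim
  · exact (PlaneTree.not_joined_of_openEnd R.nodup h' h).elim
  · exact (R.ne_zero_of_mem h'.mem.1 rfl).elim
  · exact Option.some.inj (h.symm.trans h')
  · exact (R.ne_zero_of_mem (PlaneTree.mem_of_openEnd h').1 rfl).elim
  · exact (PlaneTree.not_joined_of_openEnd R.nodup h h').elim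
  · exact (R.ne_zero_of_mem (PlaneTree.mem_of_openEnd h).1 e).elim
  · rfl

open scoped Classical in
/-- If an even number of legs is used, every used leg is joined to another one. -/
theorem exists_joined (heven : ∑ i ∈ range (d + 1), (if S i then (1 : ZMod 2) else 0) = 0) {a : ℕ}
    (ha : a ≤ d) (hS : S a) : ∃ b, R.Joined S a b := by
  have hperm : (0 :: PlaneTree.legs d).Perm (List.range (d + 1)) := by
    rw [List.perm_ext_iff_of_nodup (List.nodup_cons.2
      ⟨fun h => (PlaneTree.mem_legs.1 h).1 rfl, PlaneTree.legs_nodup d⟩) List.nodup_range]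
    intro i
    simp only [List.mem_cons, PlaneTree.mem_legs, List.mem_range]
    omega
  have hsum := (hperm.map fun i => if S i then (1 : ZMod 2) else 0).sum_eq
  have hrange : ((List.range (d + 1)).map fun i => if S i then (1 : ZMod 2) else 0).sum =
      ∑ i ∈ range (d + 1), (if S i then (1 : ZMod 2) else 0) := rfl
  rw [hrange, heven, List.map_cons, List.sum_cons, ← R.leaves_eq, PlaneTree.sum_leaves] at hsum
  by_cases ha0 : a = 0
  · subst ha0
    rcases ho : R.tree.openEnd S with _ | b
    · simp [hS, ho] at hsum
    · exact ⟨b, Or.inr ⟨hS, Or.inl ⟨rfl, ho⟩⟩⟩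
  · rcases PlaneTree.exists_joined_or_openEnd
      (t := R.tree) (R.leaves_eq ▸ PlaneTree.mem_legs.2 ⟨ha0, ha⟩) hS with h | ⟨b, hb⟩
    · refine ⟨0, Or.inr ⟨?_, Or.inr ⟨rfl, h⟩⟩⟩
      by_contra h0
      simp [h0, h] at hsum
    · exact ⟨b, Or.inl hb⟩

/-- The strands of a trivalent resolution do not cross. -/
theorem Joined.sign_joined {a b c e : ℕ} (h : R.Joined S a b) (h' : R.Joined S c e) (hca : c ≠ a)
    (hcb : c ≠ b) : ordSign (legRank d) a c * ordSign (legRank d) a e * ordSign (legRank d) b c *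
      ordSign (legRank d) b e = 1 := by
  have hK := ordSign_swap (legRank d)
  have hpw : R.tree.leaves.Pairwise fun a b => ordSign (legRank d) a b = 1 :=
    R.leaves_eq ▸ PlaneTree.legs_pairwise d
  -- the root comes before all other legs
  have h0 : ∀ {a b}, R.tree.Joined S a b →
      ordSign (legRank d) 0 a = 1 ∧ ordSign (legRank d) 0 b = 1 := by
    have : ∀ {a}, a ∈ R.tree.leaves → ordSign (legRank d) 0 a = 1 := fun {a} ha => by
      have h1 := R.ne_zero_of_mem ha
      rcases Nat.even_or_odd (0 + a) with h2 | h2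
      · rw [ordSign_legRank_of_even h1.symm h2, if_neg (Nat.not_lt_zero a)]
      · rw [ordSign_legRank_of_odd (Nat.zero_le d) (R.le_of_mem ha) h2, if_pos Even.zero]
    exact fun {a b} h => ⟨this h.mem.1, this h.symm.mem.1⟩
  have key : ∀ {a b c}, R.tree.Joined S a b → R.tree.openEnd S = some c →
      ordSign (legRank d) a 0 * ordSign (legRank d) b 0 = 1 ∧
        ordSign (legRank d) a c * ordSign (legRank d) b c = 1 := fun {a b c} h hc => by
    refine ⟨?_, PlaneTree.Joined.sign_openEnd hK hpw h hc⟩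
    rw [hK a, hK b, (h0 h).1, (h0 h).2]
    rfl
  rcases h with h | ⟨h1, ⟨rfl, h⟩ | ⟨rfl, h⟩⟩ <;>
    rcases h' with h' | ⟨h1', ⟨rfl, h'⟩ | ⟨rfl, h'⟩⟩
  · exact PlaneTree.Joined.sign_joined hK hpw h h' hca hcb
  · obtain ⟨k1, k2⟩ := key h h'
    linear_combination k1 * (ordSign (legRank d) a e * ordSign (legRank d) b e) + k2
  · obtain ⟨k1, k2⟩ := key h h'
    linear_combination k1 * (ordSign (legRank d) a c * ordSign (legRank d) b c) + k2
  · obtain ⟨k1, k2⟩ := key h' h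
    rw [hK 0 c, hK 0 e, hK b c, hK b e]
    linear_combination k1 * (ordSign (legRank d) c b * ordSign (legRank d) e b) + k2
  · exact (hca rfl).elim
  · exact (hcb (Option.some.inj (h'.symm.trans h))).elim
  · obtain ⟨k1, k2⟩ := key h' h
    rw [hK 0 c, hK 0 e, hK a c, hK a e]
    linear_combination k1 * (ordSign (legRank d) c a * ordSign (legRank d) e a) + k2
  · exact (hcb rfl).elim
  · exact (hca (Option.some.inj (h'.symm.trans h))).elim

end Resolution

open scoped Classical

/-! ### Lexicographic orders -/

/-- The order given by `r` arranges the fibres of `f` one after the other, in some order, and is the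
order given by `g` on each fibre. -/
structure IsLexRank {A B : Type*} (f : A → B) (g r : A → ℤ) : Prop where
  injective : r.Injective
  same : ∀ a b, f a = f b → ordSign r a b = ordSign g a b
  diff : ∀ a a' b b', f a = f a' → f b = f b' → f a ≠ f b → ordSign r a b = ordSign r a' b'

theorem exists_lexRank {A B : Type*} [Finite A] (f : A → B) (g : A → ℤ)
    (hfg : ∀ a b, f a = f b → g a = g b → a = b) :
    ∃ r : A → ℤ, IsLexRank f g r := by
  obtain ⟨N, hN⟩ := (Set.finite_range fun a => |g a|).bddAbove
  have hN : ∀ a, |g a| ≤ N := fun a => hN ⟨a, rfl⟩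
  let F : A → ℤ := fun a => (Finite.equivFin (Set.range f) ⟨f a, a, rfl⟩ : ℕ)
  have hF : ∀ a b, F a = F b ↔ f a = f b := by
    intro a b
    simp only [F, Nat.cast_inj, Fin.val_inj, EmbeddingLike.apply_eq_iff_eq]
    exact Subtype.ext_iff
  let r : A → ℤ := fun a => F a * (2 * N + 1) + g a
  have hlt : ∀ a b, F a < F b → r a < r b := by
    intro a b hab
    have h1 := abs_le.1 (hN a)
    have h2 := abs_le.1 (hN b)
    have h3 : (F a + 1) * (2 * N + 1) ≤ F b * (2 * N + 1) :=
      mul_le_mul_of_nonneg_right hab (by linarith)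
    simp only [r]
    linarith
  have hsame : ∀ a b, f a = f b → ordSign r a b = ordSign g a b := by
    intro a b hab
    simp only [ordSign, r, (hF a b).2 hab]
    congr 1
    ring
  have hdiff : ∀ a b, f a ≠ f b → ordSign r a b = ordSign F a b := by
    intro a b hab
    rcases lt_or_gt_of_ne (fun h => hab ((hF a b).1 h)) with h | h
    · rw [ordSign, ordSign, Int.sign_eq_one_of_pos (sub_pos.2 h),
        Int.sign_eq_one_of_pos (sub_pos.2 (hlt a b h))]
    · rw [ordSign, ordSign, Int.sign_eq_neg_one_of_neg (sub_neg.2 h),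
        Int.sign_eq_neg_one_of_neg (sub_neg.2 (hlt b a h))]
  refine ⟨r, fun a b hab => ?_, hsame, fun a a' b b' ha hb hab => ?_⟩
  · by_cases h : f a = f b
    · refine hfg a b h ?_
      have := hsame a b h
      rw [ordSign, ordSign, hab, sub_self, Int.sign_zero] at this
      exact (sub_eq_zero.1 (Int.sign_eq_zero_iff_zero.1 this.symm)).symm
    · rcases lt_or_gt_of_ne (fun h' => h ((hF a b).1 h')) with h' | h'
      · exact absurd hab (hlt a b h').ne
      · exact absurd hab (hlt b a h').ne'
  · rw [hdiff a b hab, hdiff a' b' (by rwa [← ha, ← hb]), ordSign, ordSign, (hF a a').2 ha,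
      (hF b b').2 hb]

theorem ordSign_mul_self {A : Type*} {r : A → ℤ} (hr : r.Injective) {a b : A} (hab : a ≠ b) :
    ordSign r a b * ordSign r a b = 1 := by
  rcases lt_or_gt_of_ne (fun h => hab (hr h)) with h | h
  · rw [ordSign, Int.sign_eq_one_of_pos (sub_pos.2 h)]
    rfl
  · rw [ordSign, Int.sign_eq_neg_one_of_neg (sub_neg.2 h)]
    rfl

/-- Pairs in different fibres do not cross in a lexicographic order. -/
theorem IsLexRank.noncrossing {A B : Type*} {f : A → B} {g r : A → ℤ} (hr : IsLexRank f g r)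
    {a a' b b' : A} (ha : f a = f a') (hb : f b = f b') (hab : f a ≠ f b) :
    ordSign r a b * ordSign r a b' * ordSign r a' b * ordSign r a' b' = 1 := by
  have h := ordSign_mul_self hr.injective (a := a) (b := b) fun h => hab (congrArg f h)
  rw [← hr.diff a a b b' rfl hb hab, ← hr.diff a a' b b ha rfl hab, ← hr.diff a a' b b' ha hb hab,
    h, one_mul, h]

namespace BranchedTriangulation

variable {V : Type*} {d : ℕ} {M : BranchedTriangulation V d}

/-! ### The vertex order of a simplex -/

theorem arrow_iff_not_arrow {s : Finset V} (hs : s ∈ M.faces) {u v : V} (hu : u ∈ s) (hv : v ∈ s)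
    (huv : u ≠ v) : M.arrow u v ↔ ¬ M.arrow v u :=
  M.arrow_iff u v huv ((M.isRelLowerSet_faces hs).2 (by simp [Finset.insert_subset_iff, hu, hv])
    (by simp))

theorem arrow_trans {s : Finset V} (hs : s ∈ M.faces) {u v w : V} (hu : u ∈ s) (hv : v ∈ s)
    (hw : w ∈ s) (huv : u ≠ v) (hvw : v ≠ w) (huw : u ≠ w) (h : M.arrow u v) (h' : M.arrow v w) :
    M.arrow u w := by
  rw [arrow_iff_not_arrow hs hu hw huw]
  exact fun h'' => M.acyclic u v w huv hvw huw
    ((M.isRelLowerSet_faces hs).2 (by simp [Finset.insert_subset_iff, hu, hv, hw]) (by simp))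
    ⟨h, h', h''⟩

theorem pos_lt_of_arrow {s : Finset V} (hs : s ∈ M.faces) {u v : V} (hu : u ∈ s) (hv : v ∈ s)
    (huv : u ≠ v) (h : M.arrow u v) : M.pos s u < M.pos s v := by
  refine Finset.card_lt_card (Finset.ssubset_iff_subset_ne.2 ⟨fun w hw => ?_, fun e => ?_⟩)
  · simp only [mem_filter] at hw ⊢
    have hwv : w ≠ v := by
      rintro rfl
      exact (arrow_iff_not_arrow hs hu hv huv).1 h hw.2.2
    exact ⟨hw.1, hwv, arrow_trans hs hw.1 hu hv hw.2.1 huv hwv hw.2.2 h⟩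
  · have : u ∈ s.filter fun w => w ≠ v ∧ M.arrow w v := mem_filter.2 ⟨hu, huv, h⟩
    rw [← e] at this
    exact (mem_filter.1 this).2.1 rfl

theorem pos_lt_iff {s : Finset V} (hs : s ∈ M.faces) {u v : V} (hu : u ∈ s) (hv : v ∈ s) :
    M.pos s u < M.pos s v ↔ u ≠ v ∧ M.arrow u v := by
  refine ⟨fun h => ?_, fun h => pos_lt_of_arrow hs hu hv h.1 h.2⟩
  have huv : u ≠ v := by rintro rfl; exact lt_irrefl _ h
  refine ⟨huv, ?_⟩
  rw [arrow_iff_not_arrow hs hu hv huv]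
  exact fun h' => (pos_lt_of_arrow hs hv hu huv.symm h').not_gt h

theorem pos_injOn {s : Finset V} (hs : s ∈ M.faces) : Set.InjOn (M.pos s) s := by
  intro u hu v hv h
  by_contra huv
  by_cases h' : M.arrow u v
  · exact (pos_lt_of_arrow hs hu hv huv h').ne h
  · exact (pos_lt_of_arrow hs hv hu (Ne.symm huv)
      ((arrow_iff_not_arrow hs hv hu (Ne.symm huv)).2 h')).ne h.symm

theorem card_filter_pos_lt {s : Finset V} (hs : s ∈ M.faces) {v : V} (hv : v ∈ s) :
    (s.filter fun u => M.pos s u < M.pos s v).card = M.pos s v := by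
  conv_rhs => rw [pos]
  congr 1
  exact Finset.filter_congr fun u hu => pos_lt_iff hs hu hv

theorem pos_lt_card {s : Finset V} {v : V} (hv : v ∈ s) : M.pos s v < s.card :=
  Finset.card_lt_card (Finset.ssubset_iff_subset_ne.2 ⟨Finset.filter_subset _ _, fun e => by
    rw [← e] at hv
    exact (mem_filter.1 hv).2.1 rfl⟩)

theorem image_pos {s : Finset V} (hs : s ∈ M.simplices d) : s.image (M.pos s) = range (d + 1) := by
  refine Finset.eq_of_subset_of_card_le (fun i hi => ?_) ?_
  · obtain ⟨v, hv, rfl⟩ := mem_image.1 hi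
    rw [mem_range, ← hs.2]
    exact pos_lt_card hv
  · rw [card_range, Finset.card_image_of_injOn (pos_injOn hs.1), hs.2]

/-! ### Half-edges -/

theorem index_le (h : M.HalfEdge) : M.index h ≤ d := by
  have := pos_lt_card (M := M) h.opp_mem
  rw [h.simplex_mem.2] at this
  exact Nat.lt_succ_iff.1 this

theorem eq_of_index_eq {h h' : M.HalfEdge} (hs : h.simplex = h'.simplex)
    (hi : M.index h = M.index h') : h = h' := by
  obtain ⟨s, v, hs1, hv⟩ := h
  obtain ⟨s', v', hs1', hv'⟩ := h'
  obtain rfl : s = s' := hs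
  obtain rfl : v = v' := pos_injOn hs1.1 hv hv' hi
  rfl

theorem exists_index_eq {s : Finset V} (hs : s ∈ M.simplices d) {i : ℕ} (hi : i ≤ d) :
    ∃ h : M.HalfEdge, h.simplex = s ∧ M.index h = i := by
  have : i ∈ s.image (M.pos s) := by rw [image_pos hs, mem_range]; omega
  obtain ⟨v, hv, hvi⟩ := mem_image.1 this
  exact ⟨⟨s, v, hs, hv⟩, rfl, hvi⟩

variable (M) in
/-- A half-edge is a `d`-simplex with one of its vertices. -/
def halfEdgeEquiv : M.HalfEdge ≃ Σ s : M.simplices d, {v // v ∈ s.1} where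
  toFun h := ⟨⟨h.simplex, h.simplex_mem⟩, ⟨h.opp, h.opp_mem⟩⟩
  invFun p := ⟨p.1.1, p.2.1, p.1.2, p.2.2⟩

instance : Finite (M.simplices d) := (M.finite_faces.subset fun _ hs => hs.1).to_subtype

instance : Finite M.HalfEdge := Finite.of_equiv _ M.halfEdgeEquiv.symm

theorem glue_spec (hd : 1 ≤ d) (h : M.HalfEdge) :
    M.glue h ≠ h ∧ M.facet (M.glue h) = M.facet h := by
  have := (M.existsUnique_glue hd h).exists
  rw [glue, dif_pos this]
  exact this.choose_spec

theorem eq_or_eq_glue (hd : 1 ≤ d) {h h' : M.HalfEdge} (hf : M.facet h' = M.facet h) :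
    h' = h ∨ h' = M.glue h := by
  by_cases e : h' = h
  · exact Or.inl e
  · exact Or.inr ((M.existsUnique_glue hd h).unique ⟨e, hf⟩ (glue_spec hd h))

theorem glue_glue (hd : 1 ≤ d) (h : M.HalfEdge) : M.glue (M.glue h) = h := by
  obtain ⟨h1, h2⟩ := glue_spec hd h
  exact ((eq_or_eq_glue hd h2.symm).resolve_left h1.symm).symm

/-! ### The strands of a cocycle -/

variable {p : ℕ}

theorem ev_add (α β : M.Cochain p) (t : Finset V) : M.ev (α + β) t = M.ev α t + M.ev β t := by
  unfold ev
  split_ifs <;> simp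

theorem ev_of_card_ne (α : M.Cochain p) {t : Finset V} (ht : t.card ≠ p + 1) : M.ev α t = 0 :=
  dif_neg fun h => ht h.2

theorem IsCocycle.sum_ev (hd : 1 ≤ d) {α : M.Cochain (d - 1)} (hα : M.IsCocycle α) {s : Finset V}
    (hs : s ∈ M.simplices d) : ∑ v ∈ s, M.ev α (s.erase v) = 0 :=
  congrFun hα ⟨s, hs.1, by rw [hs.2]; omega⟩

theorem IsCocycle.add {α β : M.Cochain p} (hα : M.IsCocycle α) (hβ : M.IsCocycle β) :
    M.IsCocycle (α + β) := by
  have : M.coboundary (α + β) = M.coboundary α + M.coboundary β := by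
    funext s
    simp [coboundary, ev_add, Finset.sum_add_distrib]
  rw [IsCocycle, this, show M.coboundary α = 0 from hα, show M.coboundary β = 0 from hβ, add_zero]

theorem occupied_index {α : M.Cochain p} {h : M.HalfEdge} :
    M.Occupied α h.simplex (M.index h) ↔ M.ev α (M.facet h) = 1 := by
  refine ⟨?_, fun hα => ⟨h.opp, h.opp_mem, rfl, hα⟩⟩
  rintro ⟨v, hv, hvi, hα⟩
  obtain rfl : v = h.opp := pos_injOn h.simplex_mem.1 hv h.opp_mem hvi
  exact hα

/-- A cocycle uses an even number of legs of every simplex. -/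
theorem sum_occupied (hd : 1 ≤ d) {α : M.Cochain (d - 1)} (hα : M.IsCocycle α) {s : Finset V}
    (hs : s ∈ M.simplices d) :
    ∑ i ∈ range (d + 1), (if M.Occupied α s i then (1 : ZMod 2) else 0) = 0 := by
  rw [← image_pos hs, Finset.sum_image (pos_injOn hs.1)]
  refine (Finset.sum_congr rfl ?_).trans (hα.sum_ev hd hs)
  intro v hv
  have : M.Occupied α s (M.pos s v) ↔ M.ev α (s.erase v) = 1 :=
    occupied_index (h := ⟨s, v, hs, hv⟩)
  have h2 : ∀ z : ZMod 2, z = 1 ∨ z = 0 := by decide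
  rcases h2 (M.ev α (s.erase v)) with h | h
  · rw [if_pos (this.2 h), h]
  · rw [if_neg fun h' => zero_ne_one (h.symm.trans (this.1 h')), h]

variable (R : Finset V → Resolution d)

theorem exit_spec (hd : 1 ≤ d) {α : M.Cochain (d - 1)} (hα : M.IsCocycle α) {h : M.HalfEdge}
    (hh : M.ev α (M.facet h) = 1) : (M.exit R α h).simplex = h.simplex ∧
      (R h.simplex).Joined (M.Occupied α h.simplex) (M.index h) (M.index (M.exit R α h)) := by
  have hex : ∃ h' : M.HalfEdge, h'.simplex = h.simplex ∧
      (R h.simplex).Joined (M.Occupied α h.simplex) (M.index h) (M.index h') := by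
    obtain ⟨i, hi⟩ := Resolution.exists_joined (R := R h.simplex)
      (sum_occupied hd hα h.simplex_mem) (index_le h) (occupied_index.2 hh)
    obtain ⟨h', hs, rfl⟩ := exists_index_eq h.simplex_mem hi.symm.mem.2
    exact ⟨h', hs, hi⟩
  rw [exit, dif_pos hex]
  exact hex.choose_spec

theorem ev_exit (hd : 1 ≤ d) {α : M.Cochain (d - 1)} (hα : M.IsCocycle α) {h : M.HalfEdge}
    (hh : M.ev α (M.facet h) = 1) : M.ev α (M.facet (M.exit R α h)) = 1 := by
  obtain ⟨h1, h2⟩ := exit_spec R hd hα hh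
  rw [← occupied_index, h1]
  exact h2.symm.mem.1

theorem index_exit_ne (hd : 1 ≤ d) {α : M.Cochain (d - 1)} (hα : M.IsCocycle α) {h : M.HalfEdge}
    (hh : M.ev α (M.facet h) = 1) : M.index h ≠ M.index (M.exit R α h) :=
  (exit_spec R hd hα hh).2.ne

theorem exit_exit (hd : 1 ≤ d) {α : M.Cochain (d - 1)} (hα : M.IsCocycle α) {h : M.HalfEdge}
    (hh : M.ev α (M.facet h) = 1) : M.exit R α (M.exit R α h) = h := by
  obtain ⟨h1, h2⟩ := exit_spec R hd hα hh
  obtain ⟨h3, h4⟩ := exit_spec R hd hα (ev_exit R hd hα hh)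
  rw [h1] at h3 h4
  exact eq_of_index_eq h3 (h4.unique h2.symm)

/-- The other end of the strand inside the simplex, as an involution of the used half-edges. -/
noncomputable def exitOcc (hd : 1 ≤ d) {α : M.Cochain (d - 1)} (hα : M.IsCocycle α)
    (h : M.Occ α) : M.Occ α :=
  ⟨M.exit R α h.1, ev_exit R hd hα h.2⟩

/-- The other half of the dual edge, as an involution of the used half-edges. -/
noncomputable def glueOcc (hd : 1 ≤ d) (α : M.Cochain p) (h : M.Occ α) : M.Occ α :=
  ⟨M.glue h.1, by rw [(glue_spec hd h.1).2]; exact h.2⟩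

theorem next_iterate_coe (hd : 1 ≤ d) {α : M.Cochain (d - 1)} (hα : M.IsCocycle α) (k : ℕ)
    (h : M.Occ α) :
    (((glueOcc hd α ∘ exitOcc R hd hα)^[k] h : M.Occ α) : M.HalfEdge) = (M.next R α)^[k] h := by
  have : Function.Semiconj (Subtype.val : M.Occ α → M.HalfEdge)
      (glueOcc hd α ∘ exitOcc R hd hα) (M.next R α) := fun _ => rfl
  exact (this.iterate_right k).eq h

theorem minimalPeriod_next (hd : 1 ≤ d) {α : M.Cochain (d - 1)} (hα : M.IsCocycle α)
    (h : M.Occ α) : Function.minimalPeriod (M.next R α) h.1 =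
      Function.minimalPeriod (glueOcc hd α ∘ exitOcc R hd hα) h := by
  refine Function.minimalPeriod_eq_minimalPeriod_iff.2 fun k => ?_
  rw [Function.IsPeriodicPt, Function.IsFixedPt, Function.IsPeriodicPt, Function.IsFixedPt,
    ← next_iterate_coe R hd hα, Subtype.val_inj]

/-! ### Loop phases as products of local weights -/

/-- The orientation that the `d`-simplex of `h` (branching orientation times label) induces on the
facet of `h`. -/
noncomputable def frameSign (F : M.FramingChoice) (h : M.HalfEdge) : ℤˣ :=
  F.sign h.simplex * (-1) ^ M.index h

/-- The factor of the passage through a simplex, up to the order of the two legs, that is attributed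
to the leg through which the path enters. -/
noncomputable def enterWeight (F : M.FramingChoice) (h : M.HalfEdge) : ℂ :=
  if Even (M.index h) then 1 else -Complex.I * (F.sign h.simplex : ℤ)

/-- The factor attributed to the leg through which the path leaves, including that of the crossing
of `w₁`. -/
noncomputable def leaveWeight (F : M.FramingChoice) (h : M.HalfEdge) : ℂ :=
  (if Even (M.index h) then -Complex.I * (F.sign h.simplex : ℤ) else 1) *
    if M.OnW1 F.sign h then ((F.cross h : ℤ) : ℂ) else 1

/-- The factor of a dual edge that is passed from `h` to the other half. -/
noncomputable def edgeWeight (F : M.FramingChoice) (h : M.HalfEdge) : ℂ :=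
  enterWeight F (M.glue h) * leaveWeight F h

/-- The scalar by which a step along a loop acts on the state rows. -/
noncomputable def stepWeight (F : M.FramingChoice) (R : Finset V → Resolution d) {p : ℕ}
    (α : M.Cochain p) (h : M.HalfEdge) : ℂ :=
  passWeight (F.sign h.simplex) (M.index h) (M.index (M.exit R α h)) *
    if M.OnW1 F.sign (M.exit R α h) then ((F.cross (M.exit R α h) : ℤ) : ℂ) else 1

theorem onW1_glue (hd : 1 ≤ d) (sign : Finset V → ℤˣ) (h : M.HalfEdge) :
    M.OnW1 sign (M.glue h) ↔ M.OnW1 sign h := by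
  rw [OnW1, OnW1, glue_glue hd]
  exact eq_comm

theorem neg_one_pow_index (i : ℕ) : (-1 : ℤˣ) ^ i = if Even i then 1 else -1 := by
  split_ifs with h
  · exact h.neg_one_pow
  · exact (Nat.not_even_iff_odd.1 h).neg_one_pow

/-- The weight of a dual edge changes its sign with the direction. On a wall of `w₁` this is due to
the sign of the crossing; elsewhere the labels and the parities of the two halves disagree in such a
way that the leg factors change. -/
theorem edgeWeight_glue (hd : 1 ≤ d) (F : M.FramingChoice) (h : M.HalfEdge) :
    edgeWeight F (M.glue h) = -edgeWeight F h := by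
  have hw := onW1_glue hd F.sign h
  have hc := F.cross_glue h
  have hdef : M.OnW1 F.sign h ↔ F.sign h.simplex * (-1) ^ M.index h =
      F.sign (M.glue h).simplex * (-1) ^ M.index (M.glue h) := Iff.rfl
  simp only [edgeWeight, enterWeight, leaveWeight, glue_glue hd]
  rw [neg_one_pow_index, neg_one_pow_index] at hdef
  generalize F.sign h.simplex = s at *
  generalize F.sign (M.glue h).simplex = s' at *
  have hII : ∀ z : ℂ, Complex.I * (Complex.I * z) = -z := fun z => by
    rw [← mul_assoc, Complex.I_mul_I, neg_one_mul]
  by_cases hon : M.OnW1 F.sign h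
  · rw [hc hon]
    simp only [hon, hw, if_true, true_iff] at hdef ⊢
    rcases Int.units_eq_one_or s with rfl | rfl <;> rcases Int.units_eq_one_or s' with rfl | rfl <;>
      by_cases hi : Even (M.index h) <;> by_cases hj : Even (M.index (M.glue h)) <;>
      simp only [hi, hj, if_true, if_false] at hdef ⊢ <;> simp [hII] at hdef ⊢
  · simp only [hon, hw, if_false, false_iff] at hdef ⊢
    rcases Int.units_eq_one_or s with rfl | rfl <;> rcases Int.units_eq_one_or s' with rfl | rfl <;>
      by_cases hi : Even (M.index h) <;> by_cases hj : Even (M.index (M.glue h)) <;>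
      simp only [hi, hj, if_true, if_false] at hdef ⊢ <;> simp at hdef ⊢

theorem edgeWeight_mul_self (F : M.FramingChoice) (h : M.HalfEdge) :
    edgeWeight F h * edgeWeight F h =
      if Even (M.index h + M.index (M.glue h)) then -1 else 1 := by
  have hu : ∀ u : ℤˣ, ((u : ℤ) : ℂ) * (u : ℤ) = 1 := fun u => by
    rcases Int.units_eq_one_or u with rfl | rfl <;> simp
  have hI : ∀ u : ℤˣ, -Complex.I * ((u : ℤ) : ℂ) * (-Complex.I * (u : ℤ)) = -1 := fun u => by
    rw [mul_mul_mul_comm, hu, neg_mul_neg, Complex.I_mul_I, mul_one]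
  have hc : (if M.OnW1 F.sign h then ((F.cross h : ℤ) : ℂ) else 1) *
      (if M.OnW1 F.sign h then ((F.cross h : ℤ) : ℂ) else 1) = 1 := by
    split_ifs
    · exact hu _
    · exact one_mul 1
  have hABc : ∀ A B c : ℂ, c * c = 1 → A * (B * c) * (A * (B * c)) = A * A * (B * B) :=
    fun A B c hc => by linear_combination A * A * B * B * hc
  rw [edgeWeight, leaveWeight, enterWeight, hABc _ _ _ hc]
  by_cases e4 : Even (M.index h) <;> by_cases e5 : Even (M.index (M.glue h)) <;>
    simp only [e4, e5, Nat.even_add, if_true, if_false, iff_true, true_iff, hI] <;> norm_num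

/-- The scalar of a step is a product of leg factors and of the sign of the two legs in the leg
order. -/
theorem stepWeight_eq (hd : 1 ≤ d) (F : M.FramingChoice) (R : Finset V → Resolution d)
    {α : M.Cochain (d - 1)} (hα : M.IsCocycle α) {h : M.HalfEdge} (hh : M.ev α (M.facet h) = 1) :
    stepWeight F R α h = ordSign (legRank d) (M.index h) (M.index (M.exit R α h)) *
      (enterWeight F h * leaveWeight F (M.exit R α h)) := by
  have hne := index_exit_ne R hd hα hh
  rw [stepWeight, leaveWeight, ← mul_assoc, ← mul_assoc, enterWeight, (exit_spec R hd hα hh).1,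
    passWeight]
  congr 1
  have hu : ((F.sign h.simplex : ℤ) : ℂ) * (F.sign h.simplex : ℤ) = 1 := by
    rcases Int.units_eq_one_or (F.sign h.simplex) with e | e <;> simp [e]
  have hI : -Complex.I * ((F.sign h.simplex : ℤ) : ℂ) * (-Complex.I * (F.sign h.simplex : ℤ)) =
      -1 := by
    rw [mul_mul_mul_comm, hu, neg_mul_neg, Complex.I_mul_I, mul_one]
  by_cases hp : Even (M.index h + M.index (M.exit R α h))
  · rw [ordSign_legRank_of_even hne hp, if_pos hp]
    rw [Nat.even_add] at hp
    by_cases e : Even (M.index h)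
    · rw [if_pos e, if_pos (hp.1 e)]
      split_ifs <;> push_cast <;> ring
    · rw [if_neg e, if_neg fun h' => e (hp.2 h')]
      split_ifs <;> push_cast <;> ring
  · rw [ordSign_legRank_of_odd (index_le _) (index_le _) (Nat.not_even_iff_odd.1 hp), if_neg hp]
    rw [Nat.even_add] at hp
    by_cases e : Even (M.index h)
    · rw [if_pos e, if_pos e, if_neg fun h' => hp ⟨fun _ => h', fun _ => e⟩]
      norm_num
    · have e' : Even (M.index (M.exit R α h)) := by
        by_contra e'
        exact hp ⟨fun h' => (e h').elim, fun h' => (e' h').elim⟩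
      rw [if_neg e, if_neg e, if_pos e', mul_assoc, hI]
      norm_num

/-- A step along a loop changes the state row exactly if it changes the local orientation. -/
theorem stateRow_vecMul_stepMatrix (hd : 2 ≤ d) (F : M.FramingChoice) (R : Finset V → Resolution d)
    {α : M.Cochain (d - 1)} (hα : M.IsCocycle α) {h : M.HalfEdge} (hh : M.ev α (M.facet h) = 1)
    (u : ℤˣ) : Matrix.vecMul (stateRow u) (M.stepMatrix F R α h) =
      stepWeight F R α h • stateRow (u * (frameSign F h * frameSign F (M.next R α h))) := by
  have hd1 : 1 ≤ d := by omega
  have hexit : frameSign F h * frameSign F (M.exit R α h) =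
      (-1) ^ (M.index h + M.index (M.exit R α h)) := by
    rw [frameSign, frameSign, (exit_spec R hd1 hα hh).1, mul_mul_mul_comm, Int.units_mul_self,
      one_mul, pow_add]
  have hsimp := fun u => stateRow_vecMul_simplexMatrix hd (F.sign h.simplex) u (index_le h)
    (index_le (M.exit R α h)) (index_exit_ne R hd1 hα hh)
  rw [stepMatrix, stepWeight, ← Matrix.vecMul_vecMul, next]
  by_cases hon : M.OnW1 F.sign (M.exit R α h)
  · have hfr : frameSign F (M.glue (M.exit R α h)) = frameSign F (M.exit R α h) := Eq.symm hon
    rw [if_pos hon, if_pos hon, stateRow_vecMul_crossMatrix, vecMul_smul_row, hsimp, smul_smul, hfr,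
      hexit, pow_succ, mul_neg_one, neg_mul_neg, mul_comm (passWeight _ _ _)]
  · have hfr : frameSign F (M.glue (M.exit R α h)) = -frameSign F (M.exit R α h) :=
      Int.units_ne_iff_eq_neg.1 (Ne.symm hon)
    rw [if_neg hon, if_neg hon, Matrix.vecMul_one, hsimp, mul_one, hfr, mul_neg, hexit, pow_succ,
      mul_neg_one]

theorem ev_iterate_next (hd : 1 ≤ d) (R : Finset V → Resolution d) {α : M.Cochain (d - 1)}
    (hα : M.IsCocycle α) (h : M.Occ α) (k : ℕ) :
    M.ev α (M.facet ((M.next R α)^[k] h.1)) = 1 := by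
  rw [← next_iterate_coe R hd hα]
  exact ((glueOcc hd α ∘ exitOcc R hd hα)^[k] h).2

/-- The phase of a loop is the product of the scalars of its steps. -/
theorem loopPhase_eq (hd : 2 ≤ d) (F : M.FramingChoice) (R : Finset V → Resolution d)
    {α : M.Cochain (d - 1)} (hα : M.IsCocycle α) (h : M.Occ α) :
    M.loopPhase F R α h.1 = ∏ k ∈ range (Function.minimalPeriod (M.next R α) h.1),
      stepWeight F R α ((M.next R α)^[k] h.1) := by
  rw [loopPhase, loopMatrix]
  refine upperLeft_prod (p := fun k => frameSign F ((M.next R α)^[k] h.1)) (fun k u => ?_) ?_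
  · rw [stateRow_vecMul_stepMatrix hd F R hα (ev_iterate_next (by omega) R hα h k),
      Function.iterate_succ_apply']
  · rw [Function.iterate_minimalPeriod]
    rfl

/-! ### The weight as a product over half-edges and over inversions -/

variable {r r' : M.HalfEdge → ℤ}

theorem exit_noncrossing (hd : 1 ≤ d) (R : Finset V → Resolution d) {α : M.Cochain (d - 1)}
    (hα : M.IsCocycle α) (hr : IsLexRank HalfEdge.simplex (fun h => legRank d (M.index h)) r)
    {a b : M.HalfEdge} (ha : M.ev α (M.facet a) = 1) (hb : M.ev α (M.facet b) = 1) (hba : b ≠ a)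
    (hbe : b ≠ M.exit R α a) :
    ordSign r a b * ordSign r a (M.exit R α b) * ordSign r (M.exit R α a) b *
      ordSign r (M.exit R α a) (M.exit R α b) = 1 := by
  obtain ⟨ha1, ha2⟩ := exit_spec R hd hα ha
  obtain ⟨hb1, hb2⟩ := exit_spec R hd hα hb
  by_cases hab : a.simplex = b.simplex
  · rw [hr.same _ _ hab, hr.same _ _ (hab.trans hb1.symm), hr.same _ _ (ha1.trans hab),
      hr.same _ _ (ha1.trans (hab.trans hb1.symm))]
    rw [← hab] at hb2
    exact ha2.sign_joined hb2 (fun e => hba (eq_of_index_eq hab.symm e))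
      fun e => hbe (eq_of_index_eq (hab.symm.trans ha1.symm) e)
  · exact hr.noncrossing ha1.symm hb1.symm hab

theorem glue_noncrossing (hd : 1 ≤ d) {g : M.HalfEdge → ℤ} (hr : IsLexRank M.facet g r)
    {a b : M.HalfEdge} (hba : b ≠ a) (hbg : b ≠ M.glue a) :
    ordSign r a b * ordSign r a (M.glue b) * ordSign r (M.glue a) b *
      ordSign r (M.glue a) (M.glue b) = 1 :=
  hr.noncrossing (glue_spec hd a).2.symm (glue_spec hd b).2.symm fun e =>
    (eq_or_eq_glue hd e.symm).elim hba hbg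

/-- The factor of a dual edge, attributed to its first half in the order given by `r`. -/
noncomputable def firstWeight (F : M.FramingChoice) (r : M.HalfEdge → ℤ) (h : M.HalfEdge) : ℂ :=
  if r h < r (M.glue h) then edgeWeight F h else 1

theorem edgeWeight_eq (hd : 1 ≤ d) (F : M.FramingChoice) (hr : r.Injective) (h : M.HalfEdge) :
    edgeWeight F h = ordSign r h (M.glue h) * (firstWeight F r h * firstWeight F r (M.glue h)) := by
  rw [firstWeight, firstWeight, glue_glue hd, edgeWeight_glue hd, ordSign]
  rcases lt_or_gt_of_ne (fun e => (glue_spec hd h).1 (hr e)) with e | e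
  · rw [if_pos e, if_neg e.not_gt, Int.sign_eq_neg_one_of_neg (sub_neg.2 e)]
    push_cast
    ring
  · rw [if_neg e.not_gt, if_pos e, Int.sign_eq_one_of_pos (sub_pos.2 e)]
    push_cast
    ring

theorem loops_rel_eq (hd : 1 ≤ d) (R : Finset V → Resolution d) {α : M.Cochain (d - 1)}
    (hα : M.IsCocycle α) : (fun h h' : M.Occ α => h'.1 = M.exit R α h.1 ∨ h'.1 = M.glue h.1) =
      fun h h' => h' = exitOcc R hd hα h ∨ h' = glueOcc hd α h := by
  funext h h'
  rw [Subtype.ext_iff, Subtype.ext_iff]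
  rfl

/-- The phase of a loop does not depend on the starting point or the direction. -/
theorem loopPhase_eq_of_loopOf_eq (hd : 2 ≤ d) (F : M.FramingChoice) (R : Finset V → Resolution d)
    {α : M.Cochain (d - 1)} (hα : M.IsCocycle α) {h h' : M.Occ α}
    (hh : M.loopOf R α h = M.loopOf R α h') : M.loopPhase F R α h.1 = M.loopPhase F R α h'.1 := by
  have hd1 : 1 ≤ d := by omega
  obtain ⟨r, hr⟩ := exists_lexRank (HalfEdge.simplex (M := M)) (fun h => legRank d (M.index h))
    fun a b hab h => eq_of_index_eq hab (legRank_injective (index_le a) (index_le b) h)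
  have := Fintype.ofFinite M.HalfEdge
  obtain ⟨r', hr'⟩ : ∃ r' : M.HalfEdge → ℤ, r'.Injective :=
    ⟨fun h => (Fintype.equivFin M.HalfEdge h : ℕ), fun a b hab => by
      simpa [Fin.val_inj] using hab⟩
  have hmk : (Quot.mk (fun h h' => h' = exitOcc R hd1 hα h ∨ h' = glueOcc hd1 α h) h) =
      Quot.mk _ h' := by
    rw [← loops_rel_eq]
    exact hh
  have key := prod_loop_eq_of_mk_eq (e := exitOcc R hd1 hα) (g := glueOcc hd1 α)
    (fun a => Subtype.ext (exit_exit R hd1 hα a.2)) (fun a => Subtype.ext (glue_glue hd1 a.1))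
    (r := fun a => r a.1) (r' := fun a => r' a.1) (w := fun a => stepWeight F R α a.1)
    (x := fun a => enterWeight F a.1) (y := fun a => leaveWeight F a.1)
    (u := fun a => firstWeight F r' a.1)
    (fun a => by
      have h1 : ordSign r a.1 (M.exit R α a.1) =
          ordSign (legRank d) (M.index a.1) (M.index (M.exit R α a.1)) :=
        hr.same _ _ (exit_spec R hd1 hα a.2).1.symm
      rw [stepWeight_eq hd1 F R hα a.2, ← h1]
      rfl)
    (fun a => edgeWeight_eq hd1 F hr' a.1) hmk
  rw [loopPhase_eq hd F R hα, loopPhase_eq hd F R hα, minimalPeriod_next R hd1 hα,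
    minimalPeriod_next R hd1 hα]
  simpa only [next_iterate_coe] using key

/-- The weight of a cocycle is the product of the weights of the used edges and of the signs of the
inversions between the list of the used half-edges by simplices and their list by edges. -/
theorem sigma_eq [Fintype M.HalfEdge] (hd : 2 ≤ d) (F : M.FramingChoice)
    (R : Finset V → Resolution d) {α : M.Cochain (d - 1)} (hα : M.IsCocycle α) {g : M.HalfEdge → ℤ}
    (hr : IsLexRank HalfEdge.simplex (fun h => legRank d (M.index h)) r)
    (hr' : IsLexRank M.facet g r') :
    M.sigma F R α = (∏ a : M.Occ α, firstWeight F r' a.1) *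
      ∏ a : M.Occ α, ∏ b : M.Occ α, (inversionSign r r' a.1 b.1 : ℂ) := by
  have hd1 : 1 ≤ d := by omega
  have key := prod_loops (e := exitOcc R hd1 hα) (g := glueOcc hd1 α)
    (fun a => Subtype.ext (exit_exit R hd1 hα a.2))
    (fun a ha => index_exit_ne R hd1 hα a.2 (congrArg (fun a => M.index a.1) ha).symm)
    (fun a => Subtype.ext (glue_glue hd1 a.1))
    (fun a ha => (glue_spec hd1 a.1).1 (congrArg Subtype.val ha))
    (r := fun a => r a.1) (r' := fun a => r' a.1)
    (hr.injective.comp Subtype.val_injective) (hr'.injective.comp Subtype.val_injective)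
    (fun a b hba hbe => exit_noncrossing hd1 R hα hr a.2 b.2 (fun e => hba (Subtype.ext e))
      fun e => hbe (Subtype.ext e))
    (fun a b hba hbg => glue_noncrossing hd1 hr' (fun e => hba (Subtype.ext e))
      fun e => hbg (Subtype.ext e))
    (w := fun a => stepWeight F R α a.1)
    (x := fun a => enterWeight F a.1) (y := fun a => leaveWeight F a.1)
    (u := fun a => firstWeight F r' a.1)
    (fun a => by
      have h1 : ordSign r a.1 (M.exit R α a.1) =
          ordSign (legRank d) (M.index a.1) (M.index (M.exit R α a.1)) :=
        hr.same _ _ (exit_spec R hd1 hα a.2).1.symm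
      rw [stepWeight_eq hd1 F R hα a.2, ← h1]
      rfl)
    (fun a => edgeWeight_eq hd1 F hr'.injective a.1)
  refine Eq.trans ?_ key
  unfold sigma Loops InvolutionLoops
  rw [loops_rel_eq hd1 R hα]
  congr 1
  refine finprod_congr fun l => ?_
  rw [loopPhase_eq hd F R hα, minimalPeriod_next R hd1 hα]
  simp only [next_iterate_coe]

end BranchedTriangulation

/-! ### Signs as functions on `ZMod 2` -/

/-- The sign `(-1) ^ z`. -/
noncomputable def paritySign (z : ZMod 2) : ℂ := (-1) ^ z.val

theorem zmod_two_cases (z : ZMod 2) : z = 0 ∨ z = 1 := by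
  revert z; decide

theorem paritySign_add (z w : ZMod 2) : paritySign (z + w) = paritySign z * paritySign w := by
  rcases zmod_two_cases z with rfl | rfl <;> rcases zmod_two_cases w with rfl | rfl <;>
    simp [paritySign, ZMod.val_one, show (1 : ZMod 2) + 1 = 0 from rfl]

theorem paritySign_zero : paritySign 0 = 1 := by simp [paritySign]

theorem paritySign_one : paritySign 1 = -1 := by simp [paritySign, ZMod.val_one]

theorem paritySign_sum {ι : Type*} (s : Finset ι) (f : ι → ZMod 2) :
    paritySign (∑ i ∈ s, f i) = ∏ i ∈ s, paritySign (f i) := by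
  induction s using Finset.induction_on with
  | empty => simp [paritySign_zero]
  | insert a s ha ih => rw [Finset.sum_insert ha, Finset.prod_insert ha, paritySign_add, ih]

/-- `1` if `a` comes before `b` in the order given by `r`, and `0` otherwise. -/
noncomputable def before {A : Type*} (r : A → ℤ) (a b : A) : ZMod 2 := if r a < r b then 1 else 0

theorem before_add_swap {A : Type*} {r : A → ℤ} {a b : A} (hab : r a ≠ r b) :
    before r a b + before r b a = 1 := by
  unfold before
  rcases lt_or_gt_of_ne hab with h | h <;> simp [h, h.not_gt]

theorem before_eq_ordSign {A : Type*} (r : A → ℤ) (a b : A) :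
    before r a b = if ordSign r a b = 1 then 1 else 0 := by
  simp only [before, ordSign, Int.sign_eq_one_iff_pos, sub_pos]

theorem before_eq_of_ordSign_eq {A A' : Type*} {r : A → ℤ} {r' : A' → ℤ} {a b : A} {a' b' : A'}
    (h : ordSign r a b = ordSign r' a' b') : before r a b = before r' a' b' := by
  rw [before_eq_ordSign, before_eq_ordSign, h]

theorem inversionSign_eq {A : Type*} (r r' : A → ℤ) (a b : A) :
    (inversionSign r r' a b : ℂ) = paritySign (before r a b * before r' b a) := by
  unfold inversionSign before
  by_cases h : r a < r b <;> by_cases h' : r' b < r' a <;>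
    simp [h, h', paritySign_zero, paritySign_one]

/-- The quadratic form that counts the inversions between two orders has the polarisation given by
the sum of the orders. -/
theorem inversions_add {A : Type*} [Fintype A] {r r' : A → ℤ} (hr : r.Injective)
    (hr' : r'.Injective) (x y : A → ZMod 2) :
    ∑ a, ∑ b, before r a b * before r' b a * ((x a + y a) * (x b + y b)) =
      ∑ a, ∑ b, before r a b * before r' b a * (x a * x b) +
      ∑ a, ∑ b, before r a b * before r' b a * (y a * y b) +
      (∑ a, ∑ b, before r a b * (x a * y b) + ∑ a, ∑ b, before r' a b * (x a * y b)) := by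
  have h1 : ∑ a, ∑ b, before r a b * before r' b a * (y a * x b) =
      ∑ a, ∑ b, before r b a * before r' a b * (x a * y b) := by
    rw [Finset.sum_comm]
    exact Finset.sum_congr rfl fun a _ => Finset.sum_congr rfl fun b _ => by ring
  have h2 : ∀ a b, before r a b * before r' b a + before r b a * before r' a b =
      before r a b + before r' a b := by
    intro a b
    by_cases hab : a = b
    · subst hab
      simp [before]
    · rw [eq_comm, ← sub_eq_zero]
      have e1 := before_add_swap (r := r) fun h => hab (hr h)
      have e2 := before_add_swap (r := r') fun h => hab (hr' h)
      revert e1 e2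
      generalize before r a b = p
      generalize before r b a = q
      generalize before r' a b = p'
      generalize before r' b a = q'
      revert p q p' q'
      decide
  have h3 : ∑ a, ∑ b, before r a b * (x a * y b) + ∑ a, ∑ b, before r' a b * (x a * y b) =
      ∑ a, ∑ b, before r a b * before r' b a * (x a * y b) +
        ∑ a, ∑ b, before r b a * before r' a b * (x a * y b) := by
    simp only [← Finset.sum_add_distrib, ← add_mul, h2]
  rw [h3, ← h1]
  simp only [← Finset.sum_add_distrib]
  exact Finset.sum_congr rfl fun a _ => Finset.sum_congr rfl fun b _ => by ring

/-! ### The higher cup product on a simplex -/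

section Simplex

variable {V : Type*} {s : Finset V} {P : V → ℕ}

/-- The comparison, on one simplex, of the `∪_{d-2}` product with the order of the legs. Here `P` is
the position of a vertex, `l` the leg order, and `x v`, `y v` are the values of two cochains on the
facet opposite to `v`. -/
theorem cup_sum_eq (hP : Set.InjOn P s) {l : V → ℤ}
    (heven : ∀ v ∈ s, ∀ w ∈ s, Even (P v + P w) → (l v < l w ↔ P v < P w))
    (hodd : ∀ v ∈ s, ∀ w ∈ s, Odd (P v + P w) → (l v < l w ↔ Even (P v))) {x y : V → ZMod 2}
    (hy : ∑ v ∈ s, y v = 0) :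
    ∑ v ∈ s, ∑ w ∈ s, (if P v < P w then
        (if Even (P v) ∧ Even (P w) then x w * y v else
          if Odd (P v) ∧ Odd (P w) then x v * y w else 0) else 0) =
      ∑ v ∈ s, ∑ w ∈ s, before l v w * (x v * y w) + ∑ v ∈ s, (P v : ZMod 2) * (x v * y v) +
        ∑ v ∈ s, x v * y v := by
  have h2 : ∀ z : ZMod 2, z + z = 0 := by decide
  have h11 : (1 : ZMod 2) + 1 = 0 := rfl
  have hcast : ∀ n : ℕ, (n : ZMod 2) = if Even n then 0 else 1 := by
    intro n
    split_ifs with h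
    · exact (ZMod.natCast_eq_zero_iff_even).2 h
    · exact (ZMod.natCast_eq_one_iff_odd).2 (Nat.not_even_iff_odd.1 h)
  let e : V → ZMod 2 := fun v => if Even (P v) then 1 else 0
  let L : V → V → ZMod 2 := fun v w => if P v < P w then 1 else 0
  have hT : ∀ v w, (if P v < P w then
        (if Even (P v) ∧ Even (P w) then x w * y v else
          if Odd (P v) ∧ Odd (P w) then x v * y w else 0) else 0) =
      L v w * (e v * e w) * (x w * y v) + L v w * ((1 + e v) * (1 + e w)) * (x v * y w) := by
    intro v w
    simp only [L, e, ← Nat.not_even_iff_odd]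
    by_cases h1 : P v < P w <;> by_cases h3 : Even (P v) <;> by_cases h4 : Even (P w) <;>
      simp [h1, h3, h4, h11]
  have hB : ∀ v ∈ s, ∀ w ∈ s, before l v w =
      e v * (1 + e w) + L v w * (e v * e w) + L v w * ((1 + e v) * (1 + e w)) := by
    intro v hv w hw
    unfold before
    rcases Nat.even_or_odd (P v + P w) with h | h
    · rw [if_congr (heven v hv w hw h) rfl rfl]
      rw [Nat.even_add] at h
      simp only [L, e]
      by_cases h3 : Even (P v)
      · simp [if_pos h3, if_pos (h.1 h3), h11]
      · simp [if_neg h3, if_neg fun h4 => h3 (h.2 h4)]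
    · rw [if_congr (hodd v hv w hw h) rfl rfl]
      rw [Nat.odd_add, ← Nat.not_even_iff_odd] at h
      simp only [L, e]
      rcases Classical.em (Even (P v)) with h3 | h3 <;>
        rcases Classical.em (Even (P w)) with h4 | h4
      · exact ((h.2 h4) h3).elim
      · simp [if_pos h3, if_neg h4, h11]
      · simp [if_neg h3, if_pos h4, h11]
      · exact (h4 (h.1 h3)).elim
  -- one of two different vertices comes first
  have hL : ∀ v ∈ s, ∀ w ∈ s, L v w + L w v + 1 = if v = w then 1 else 0 := by
    intro v hv w hw
    by_cases h : v = w
    · simp [L, h]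
    · rcases lt_or_gt_of_ne (fun h' => h (hP hv hw h')) with h1 | h1 <;>
        simp [L, h, h1, h1.not_gt, h11]
  -- the cocycle condition trades the pairs of different parity for all pairs of even vertices
  have hcross : ∑ v ∈ s, ∑ w ∈ s, e v * (1 + e w) * (x v * y w) =
      ∑ v ∈ s, ∑ w ∈ s, e v * e w * (x v * y w) := by
    have h3 : ∀ v, ∑ w ∈ s, e v * (1 + e w) * (x v * y w) =
        e v * x v * ∑ w ∈ s, y w + ∑ w ∈ s, e v * e w * (x v * y w) := by
      intro v
      rw [Finset.mul_sum, ← Finset.sum_add_distrib]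
      exact Finset.sum_congr rfl fun w _ => by ring
    exact Finset.sum_congr rfl fun v _ => by rw [h3, hy, mul_zero, zero_add]
  have hdiag : ∑ v ∈ s, ∑ w ∈ s, (L v w + L w v + 1) * (e v * e w * (x v * y w)) =
      ∑ v ∈ s, e v * (x v * y v) := by
    refine Finset.sum_congr rfl fun v hv => ?_
    rw [Finset.sum_eq_single_of_mem v hv]
    · rw [hL v hv v hv, if_pos rfl]
      simp only [e]
      split_ifs <;> simp
    · intro w hw hwv
      rw [hL v hv w hw, if_neg hwv.symm, zero_mul]
  have hswap : ∑ v ∈ s, ∑ w ∈ s, L v w * (e v * e w) * (x w * y v) =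
      ∑ v ∈ s, ∑ w ∈ s, L w v * (e v * e w * (x v * y w)) := by
    rw [Finset.sum_comm]
    exact Finset.sum_congr rfl fun v _ => Finset.sum_congr rfl fun w _ => by ring
  have hPe : ∑ v ∈ s, (P v : ZMod 2) * (x v * y v) + ∑ v ∈ s, x v * y v =
      ∑ v ∈ s, e v * (x v * y v) := by
    rw [← Finset.sum_add_distrib]
    refine Finset.sum_congr rfl fun v _ => ?_
    rw [hcast]
    simp only [e]
    split_ifs <;> simp [h2]
  have hB' : ∑ v ∈ s, ∑ w ∈ s, before l v w * (x v * y w) =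
      ∑ v ∈ s, ∑ w ∈ s, e v * (1 + e w) * (x v * y w) +
      ∑ v ∈ s, ∑ w ∈ s, L v w * (e v * e w * (x v * y w)) +
      ∑ v ∈ s, ∑ w ∈ s, L v w * ((1 + e v) * (1 + e w)) * (x v * y w) := by
    simp only [← Finset.sum_add_distrib]
    exact Finset.sum_congr rfl fun v hv => Finset.sum_congr rfl fun w hw => by
      rw [hB v hv w hw]; ring
  simp only [hT]
  rw [add_assoc, hPe, ← hdiag, hB', hcross]
  simp only [add_mul, one_mul, Finset.sum_add_distrib]
  rw [hswap]
  generalize ∑ v ∈ s, ∑ w ∈ s, L w v * (e v * e w * (x v * y w)) = a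
  have h4 := h2 (∑ v ∈ s, ∑ w ∈ s, L v w * (e v * e w * (x v * y w)))
  have h5 := h2 (∑ v ∈ s, ∑ w ∈ s, e v * e w * (x v * y w))
  linear_combination -h4 - h5

end Simplex

/-! ### Sums over half-edges -/

theorem prod_subtype_eq_one {A : Type*} [Fintype A] (x : A → ZMod 2) (U : A → ℂ) :
    ∏ a : {a // x a = 1}, U a.1 = ∏ a, if x a = 1 then U a else 1 := by
  rw [← Finset.prod_filter]
  exact (Finset.prod_subtype (univ.filter fun a => x a = 1) (by simp) U).symm

/-- If `y` sums to zero over the fibres of `f`, only pairs inside a fibre contribute. -/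
theorem sum_before_mul {A B : Type*} [Fintype A] [DecidableEq B] {f : A → B} {g r : A → ℤ}
    (hr : IsLexRank f g r) {y : A → ZMod 2} (hy : ∀ a, ∑ b with f b = f a, y b = 0) (a : A) :
    ∑ b, before r a b * y b = ∑ b with f b = f a, before r a b * y b := by
  rw [← Finset.sum_filter_add_sum_filter_not univ fun b => f b = f a]
  refine (add_eq_left).2 ?_
  rw [← Finset.sum_fiberwise_of_maps_to (t := (univ.filter fun b => ¬ f b = f a).image f) (g := f)
    fun b hb => mem_image_of_mem f hb]
  refine Finset.sum_eq_zero fun j hj => ?_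
  obtain ⟨b, hb, rfl⟩ := mem_image.1 hj
  have hb := (mem_filter.1 hb).2
  have h1 : (univ.filter fun c => ¬ f c = f a).filter (fun c => f c = f b) =
      univ.filter fun c => f c = f b := by
    ext c
    simp only [mem_filter, mem_univ, true_and, and_iff_right_iff_imp]
    intro hc
    rwa [hc]
  rw [h1, Finset.sum_congr rfl fun c hc => by
    rw [before_eq_of_ordSign_eq (hr.diff a a c b rfl (mem_filter.1 hc).2
      fun e => hb ((mem_filter.1 hc).2.symm.trans e.symm))], ← Finset.mul_sum, hy, mul_zero]

namespace BranchedTriangulation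

variable {V : Type*} {d : ℕ} {M : BranchedTriangulation V d}

theorem sum_halfEdge [Fintype M.HalfEdge] [Fintype (M.simplices d)] (G : Finset V → V → ZMod 2) :
    ∑ h : M.HalfEdge, G h.simplex h.opp = ∑ s : M.simplices d, ∑ v ∈ s.1, G s.1 v := by
  refine (Fintype.sum_equiv M.halfEdgeEquiv _
    (fun p : Σ s : M.simplices d, {v // v ∈ s.1} => G p.1.1 p.2.1) fun _ => rfl).trans ?_
  rw [Fintype.sum_sigma]
  exact Finset.sum_congr rfl fun s _ => Finset.sum_coe_sort s.1 (G s.1)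

theorem sum_halfEdge_of_simplex [Fintype M.HalfEdge] {s : Finset V} (hs : s ∈ M.simplices d)
    (G : V → ZMod 2) : ∑ h : M.HalfEdge with h.simplex = s, G h.opp = ∑ v ∈ s, G v := by
  have := Fintype.ofFinite (M.simplices d)
  rw [Finset.sum_filter, sum_halfEdge fun t v => if t = s then G v else 0,
    Finset.sum_eq_single (⟨s, hs⟩ : M.simplices d)]
  · simp
  · intro t _ ht
    exact Finset.sum_eq_zero fun v _ => if_neg fun e => ht (Subtype.ext e)
  · simp

/-- Every facet is shared by two half-edges. -/
theorem sum_facet [Fintype M.HalfEdge] (hd : 1 ≤ d) (G : M.HalfEdge → ZMod 2) (a : M.HalfEdge) :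
    ∑ b with M.facet b = M.facet a, G b = G a + G (M.glue a) := by
  have : (univ.filter fun b => M.facet b = M.facet a) = {a, M.glue a} := by
    ext b
    simp only [mem_filter, mem_univ, true_and, mem_insert, mem_singleton]
    refine ⟨eq_or_eq_glue hd, ?_⟩
    rintro (rfl | rfl)
    · rfl
    · exact (glue_spec hd a).2
  rw [this, Finset.sum_pair (glue_spec hd a).1.symm]

/-! ### The `∪_{d-2}` product of two `(d-1)`-cochains -/

theorem card_filter_erase_erase {s : Finset V} (hs : s ∈ M.faces) {v w : V} (hv : v ∈ s)
    (hw : w ∈ s) (hvw : M.pos s v < M.pos s w) :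
    (((s.erase v).erase w).filter fun j => M.pos s j < M.pos s v).card = M.pos s v ∧
      (((s.erase v).erase w).filter fun j => M.pos s j < M.pos s w).card = M.pos s w - 1 := by
  constructor
  · rw [← card_filter_pos_lt hs hv]
    congr 1
    ext u
    simp only [mem_filter, mem_erase, card_filter_pos_lt hs hv]
    refine ⟨fun h => ⟨h.1.2.2, h.2⟩, fun h => ⟨⟨?_, ?_, h.1⟩, h.2⟩⟩
    · rintro rfl; exact hvw.not_gt h.2
    · rintro rfl; exact lt_irrefl _ h.2
  · have h1 : (((s.erase v).erase w).filter fun j => M.pos s j < M.pos s w) =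
        (s.filter fun j => M.pos s j < M.pos s w).erase v := by
      ext u
      simp only [mem_filter, mem_erase]
      refine ⟨fun h => ⟨h.1.2.1, h.1.2.2, h.2⟩, fun h => ⟨⟨?_, h.1, h.2.1⟩, h.2.2⟩⟩
      rintro rfl; exact lt_irrefl _ h.2.2
    rw [h1, card_erase_of_mem (mem_filter.2 ⟨hv, hvw⟩), card_filter_pos_lt hs hw]

/-- If the `d - 1` dividing vertices leave out `v` and `w`, both blocks have `d` vertices exactly if
the positions of `v` and `w` have equal parity. -/
theorem blocks_term (hd : 2 ≤ d) {s : Finset V} (hs : s ∈ M.simplices d) {v w : V} (hv : v ∈ s)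
    (hw : w ∈ s) (hvw : M.pos s v < M.pos s w) (β β' : M.Cochain (d - 1)) :
    M.ev β (M.evenBlocks s ((s.erase v).erase w)) * M.ev β' (M.oddBlocks s ((s.erase v).erase w)) =
      if Even (M.pos s v) ∧ Even (M.pos s w) then
        M.ev β (s.erase w) * M.ev β' (s.erase v) else
        if Odd (M.pos s v) ∧ Odd (M.pos s w) then
          M.ev β (s.erase v) * M.ev β' (s.erase w) else 0 := by
  obtain ⟨c1, c2⟩ := card_filter_erase_erase hs.1 hv hw hvw
  have hne : v ≠ w := by rintro rfl; exact lt_irrefl _ hvw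
  have hpos : 0 < M.pos s w := by omega
  have hE : ∀ u, u ∈ M.evenBlocks s ((s.erase v).erase w) ↔
      u ∈ s ∧ (u = v → Even (M.pos s v)) ∧ (u = w → Odd (M.pos s w)) := by
    intro u
    simp only [evenBlocks, mem_filter]
    refine and_congr_right fun hu => ?_
    by_cases h1 : u = v
    · subst h1
      simp [c1, hne]
    · by_cases h2 : u = w
      · subst h2
        simp only [c2, mem_erase, h1, hu]
        simp [Nat.even_sub (show 1 ≤ M.pos s u from hpos)]
      · simp [h1, h2, hu]
  have hO : ∀ u, u ∈ M.oddBlocks s ((s.erase v).erase w) ↔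
      u ∈ s ∧ (u = v → Odd (M.pos s v)) ∧ (u = w → Even (M.pos s w)) := by
    intro u
    simp only [oddBlocks, mem_filter]
    refine and_congr_right fun hu => ?_
    by_cases h1 : u = v
    · subst h1
      simp [c1, hne]
    · by_cases h2 : u = w
      · subst h2
        simp only [c2, mem_erase, h1, hu]
        simp [Nat.odd_sub (show 1 ≤ M.pos s u from hpos)]
      · simp [h1, h2, hu]
  have hfull : ∀ t : Finset V, t = s → ∀ γ : M.Cochain (d - 1), M.ev γ t = 0 := fun t ht γ =>
    ev_of_card_ne γ (by rw [ht, hs.2]; omega)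
  rcases Nat.even_or_odd (M.pos s v) with h1 | h1 <;>
    rcases Nat.even_or_odd (M.pos s w) with h2 | h2
  · rw [if_pos ⟨h1, h2⟩]
    congr 2
    · ext u
      rw [hE, mem_erase]
      simp only [h1, ← Nat.not_even_iff_odd, h2]
      tauto
    · ext u
      rw [hO, mem_erase]
      simp only [h1, ← Nat.not_even_iff_odd, h2]
      tauto
  · rw [if_neg fun h => Nat.not_even_iff_odd.2 h2 h.2,
      if_neg fun h => Nat.not_odd_iff_even.2 h1 h.1,
      hfull (M.evenBlocks s _), zero_mul]
    ext u
    rw [hE]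
    simp only [h1, h2]
    tauto
  · rw [if_neg fun h => Nat.not_even_iff_odd.2 h1 h.1,
      if_neg fun h => Nat.not_odd_iff_even.2 h2 h.2,
      hfull (M.oddBlocks s _), mul_zero]
    ext u
    rw [hO]
    simp only [h1, h2]
    tauto
  · rw [if_neg fun h => Nat.not_even_iff_odd.2 h1 h.1, if_pos ⟨h1, h2⟩]
    congr 2
    · ext u
      rw [hE, mem_erase]
      simp only [← Nat.not_odd_iff_even, h1, h2]
      tauto
    · ext u
      rw [hO, mem_erase]
      simp only [← Nat.not_odd_iff_even, h1, h2]
      tauto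

/-- The `∪_{d-2}` product as a sum over the pairs of vertices that are left out by the `d - 1`
vertices that divide the blocks. -/
theorem cup_apply (hd : 2 ≤ d) (s : M.simplices d) (β β' : M.Cochain (d - 1)) :
    M.cup (d - 2) β β' d s = ∑ v ∈ s.1, ∑ w ∈ s.1, if M.pos s.1 v < M.pos s.1 w then
        (if Even (M.pos s.1 v) ∧ Even (M.pos s.1 w) then
          M.ev β (s.1.erase w) * M.ev β' (s.1.erase v) else
        if Odd (M.pos s.1 v) ∧ Odd (M.pos s.1 w) then
          M.ev β (s.1.erase v) * M.ev β' (s.1.erase w) else 0) else 0 := by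
  obtain ⟨s, hs⟩ := s
  rw [← Finset.sum_product', ← Finset.sum_filter, cup]
  symm
  refine Finset.sum_bij (fun p _ => (s.erase p.1).erase p.2) ?_ ?_ ?_ ?_
  · rintro ⟨v, w⟩ hp
    simp only [mem_filter, mem_product] at hp
    obtain ⟨⟨hv, hw⟩, hvw⟩ := hp
    have hne : w ≠ v := by rintro rfl; exact lt_irrefl _ hvw
    rw [mem_powersetCard]
    refine ⟨(erase_subset _ _).trans (erase_subset _ _), ?_⟩
    rw [card_erase_of_mem (mem_erase.2 ⟨hne, hw⟩), card_erase_of_mem hv, hs.2]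
    omega
  · rintro ⟨v, w⟩ hp ⟨v', w'⟩ hp' heq
    simp only [mem_filter, mem_product] at hp hp'
    obtain ⟨⟨hv, hw⟩, hvw⟩ := hp
    obtain ⟨⟨hv', hw'⟩, hvw'⟩ := hp'
    have h1 : ∀ u ∈ s, (u = v ∨ u = w) ↔ (u = v' ∨ u = w') := by
      intro u hu
      have := Finset.ext_iff.1 heq u
      simp only [mem_erase, hu] at this
      tauto
    rcases (h1 v hv).1 (Or.inl rfl) with e1 | e1 <;> rcases (h1 w hw).1 (Or.inr rfl) with e2 | e2
    · rw [e1, e2] at hvw; exact absurd hvw (lt_irrefl _)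
    · rw [e1, e2]
    · rw [e1, e2] at hvw; exact absurd hvw hvw'.not_gt
    · rw [e1, e2] at hvw; exact absurd hvw (lt_irrefl _)
  · intro J hJ
    obtain ⟨hJs, hJc⟩ := mem_powersetCard.1 hJ
    have hc : (s \ J).card = 2 := by rw [card_sdiff_of_subset hJs, hJc, hs.2]; omega
    obtain ⟨a, b, hab, hset⟩ := card_eq_two.1 hc
    have ha : a ∈ s \ J := by rw [hset]; simp
    have hb : b ∈ s \ J := by rw [hset]; simp
    have hJ' : (s.erase a).erase b = J := by
      rw [← Finset.sdiff_sdiff_eq_self hJs, hset]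
      ext u
      simp only [mem_erase, mem_sdiff, mem_insert, mem_singleton]
      tauto
    rw [mem_sdiff] at ha hb
    rcases lt_or_gt_of_ne (fun h => hab (pos_injOn hs.1 ha.1 hb.1 h)) with h | h
    · exact ⟨(a, b), by simp [ha.1, hb.1, h], hJ'⟩
    · exact ⟨(b, a), by simp [ha.1, hb.1, h], by rw [← hJ', erase_right_comm]⟩
  · rintro ⟨v, w⟩ hp
    simp only [mem_filter, mem_product] at hp
    obtain ⟨⟨hv, hw⟩, hvw⟩ := hp
    exact (blocks_term hd hs hv hw hvw β β').symm

/-- The integral of the `∪_{d-2}` product in terms of the order of the legs. -/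
theorem integral_cup [Fintype M.HalfEdge] (hd : 2 ≤ d) {r : M.HalfEdge → ℤ}
    (hr : IsLexRank HalfEdge.simplex (fun h => legRank d (M.index h)) r)
    (β : M.Cochain (d - 1)) {β' : M.Cochain (d - 1)} (hβ' : M.IsCocycle β') :
    M.integral (M.cup (d - 2) β β' d) =
      ∑ a, ∑ b, before r a b * (M.ev β (M.facet a) * M.ev β' (M.facet b)) +
      ∑ a, (M.index a : ZMod 2) * (M.ev β (M.facet a) * M.ev β' (M.facet a)) +
      ∑ a, M.ev β (M.facet a) * M.ev β' (M.facet a) := by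
  have hd1 : 1 ≤ d := by omega
  have := Fintype.ofFinite (M.simplices d)
  have hbefore : ∑ a, ∑ b, before r a b * (M.ev β (M.facet a) * M.ev β' (M.facet b)) =
      ∑ s : M.simplices d, ∑ v ∈ s.1, ∑ w ∈ s.1,
        before (fun u => legRank d (M.pos s.1 u)) v w *
          (M.ev β (s.1.erase v) * M.ev β' (s.1.erase w)) := by
    rw [← sum_halfEdge fun s v => ∑ w ∈ s, before (fun u => legRank d (M.pos s u)) v w *
          (M.ev β (s.erase v) * M.ev β' (s.erase w))]
    refine Finset.sum_congr rfl fun a _ => ?_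
    have h1 : ∀ a : M.HalfEdge, ∑ b with b.simplex = a.simplex, M.ev β' (M.facet b) = 0 := by
      intro a
      rw [← hβ'.sum_ev hd1 a.simplex_mem, ← sum_halfEdge_of_simplex a.simplex_mem]
      refine Finset.sum_congr rfl fun b hb => ?_
      rw [facet, (mem_filter.1 hb).2]
    have h2 := sum_before_mul hr (y := fun b => M.ev β' (M.facet b)) h1 a
    rw [← sum_halfEdge_of_simplex a.simplex_mem]
    calc _ = M.ev β (M.facet a) * ∑ b, before r a b * M.ev β' (M.facet b) := by
          rw [Finset.mul_sum]
          exact Finset.sum_congr rfl fun b _ => by ring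
      _ = _ := by
          rw [h2, Finset.mul_sum]
          refine Finset.sum_congr rfl fun b hb => ?_
          have hb := (mem_filter.1 hb).2
          have h3 : before r a b =
              before (fun u => legRank d (M.pos a.simplex u)) a.opp b.opp := by
            refine before_eq_of_ordSign_eq ((hr.same a b hb.symm).trans ?_)
            rw [ordSign, ordSign, index, index, hb]
          rw [h3, facet, facet, hb]
          ring
  rw [hbefore, integral, finsum_eq_sum_of_fintype]
  have e1 : ∑ a, (M.index a : ZMod 2) * (M.ev β (M.facet a) * M.ev β' (M.facet a)) =
      ∑ s : M.simplices d, ∑ v ∈ s.1,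
        (M.pos s.1 v : ZMod 2) * (M.ev β (s.1.erase v) * M.ev β' (s.1.erase v)) :=
    sum_halfEdge fun s v => (M.pos s v : ZMod 2) * (M.ev β (s.erase v) * M.ev β' (s.erase v))
  have e2 : ∑ a, M.ev β (M.facet a) * M.ev β' (M.facet a) =
      ∑ s : M.simplices d, ∑ v ∈ s.1, M.ev β (s.1.erase v) * M.ev β' (s.1.erase v) :=
    sum_halfEdge fun s v => M.ev β (s.erase v) * M.ev β' (s.erase v)
  rw [e1, e2, ← Finset.sum_add_distrib, ← Finset.sum_add_distrib]
  refine Finset.sum_congr rfl fun s _ => ?_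
  rw [cup_apply hd]
  have hle : ∀ v ∈ s.1, M.pos s.1 v ≤ d := fun v hv => by
    have := pos_lt_card (M := M) hv
    rw [s.2.2] at this
    omega
  refine cup_sum_eq (P := M.pos s.1) (x := fun v => M.ev β (s.1.erase v))
    (y := fun v => M.ev β' (s.1.erase v)) (pos_injOn s.2.1) ?_ ?_ (hβ'.sum_ev hd1 s.2)
  · intro v hv w hw h
    by_cases hvw : M.pos s.1 v = M.pos s.1 w
    · rw [hvw]
      simp
    · have h1 := ordSign_legRank_of_even (d := d) hvw h
      rw [← sub_pos, ← Int.sign_eq_one_iff_pos]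
      rw [ordSign] at h1
      rw [h1]
      split_ifs with h2
      · simpa using h2.le
      · simpa using lt_of_le_of_ne (not_lt.1 h2) hvw
  · intro v hv w hw h
    have h1 := ordSign_legRank_of_odd (hle v hv) (hle w hw) h
    rw [← sub_pos, ← Int.sign_eq_one_iff_pos]
    rw [ordSign] at h1
    rw [h1]
    split_ifs with h2
    · simpa using h2
    · simpa using h2

/-! ### The weight of a sum of cocycles -/

/-- The weight of a cocycle as a product of edge weights and the sign of a quadratic form. -/
theorem sigma_eq_paritySign [Fintype M.HalfEdge] (hd : 2 ≤ d) (F : M.FramingChoice)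
    (R : Finset V → Resolution d) {α : M.Cochain (d - 1)} (hα : M.IsCocycle α)
    {r r' g : M.HalfEdge → ℤ}
    (hr : IsLexRank HalfEdge.simplex (fun h => legRank d (M.index h)) r)
    (hr' : IsLexRank M.facet g r') :
    M.sigma F R α = (∏ a, if M.ev α (M.facet a) = 1 then firstWeight F r' a else 1) *
      paritySign (∑ a, ∑ b, before r a b * before r' b a *
        (M.ev α (M.facet a) * M.ev α (M.facet b))) := by
  rw [sigma_eq hd F R hα hr hr',
    prod_subtype_eq_one (fun a => M.ev α (M.facet a)) (firstWeight F r')]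
  congr 1
  rw [paritySign_sum]
  simp only [paritySign_sum, inversionSign_eq]
  rw [prod_subtype_eq_one (fun a => M.ev α (M.facet a)) fun a =>
    ∏ b : M.Occ α, paritySign (before r a b.1 * before r' b.1 a)]
  refine Finset.prod_congr rfl fun a _ => ?_
  rw [prod_subtype_eq_one (fun a => M.ev α (M.facet a)) fun b =>
    paritySign (before r a b * before r' b a)]
  rcases zmod_two_cases (M.ev α (M.facet a)) with h | h
  · simp [h, paritySign_zero]
  · rw [if_pos h, h]
    refine Finset.prod_congr rfl fun b _ => ?_
    rcases zmod_two_cases (M.ev α (M.facet b)) with h' | h'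
    · simp [h', paritySign_zero]
    · simp [h']

theorem firstWeight_mul_self (F : M.FramingChoice) (r : M.HalfEdge → ℤ) (h : M.HalfEdge) :
    firstWeight F r h * firstWeight F r h = paritySign (before r h (M.glue h) *
      (1 + (M.index h + M.index (M.glue h)))) := by
  unfold firstWeight before
  split_ifs
  · rw [edgeWeight_mul_self, one_mul, ← Nat.cast_add]
    split_ifs with h1
    · rw [(ZMod.natCast_eq_zero_iff_even).2 h1, add_zero, paritySign_one]
    · rw [(ZMod.natCast_eq_one_iff_odd).2 (Nat.not_even_iff_odd.1 h1),
        show (1 : ZMod 2) + 1 = 0 from rfl, paritySign_zero]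
  · rw [zero_mul, paritySign_zero, one_mul]

theorem ite_mul_ite_eq {u : ℂ} {q : ZMod 2} (hu : u * u = paritySign q) (x y : ZMod 2) :
    ((if x = 1 then u else 1) * if y = 1 then u else 1) =
      paritySign (q * (x * y)) * if x + y = 1 then u else 1 := by
  rcases zmod_two_cases x with rfl | rfl <;> rcases zmod_two_cases y with rfl | rfl <;>
    simp [paritySign_zero, hu, show (1 : ZMod 2) + 1 = 0 from rfl]

/-- The exponents that come from the squares of the edge weights and from the order in which the two
halves of an edge are listed add up to the indices of the half-edges. -/
theorem sum_before_glue [Fintype M.HalfEdge] (hd : 1 ≤ d) {r : M.HalfEdge → ℤ} (hr : r.Injective)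
    {z : M.HalfEdge → ZMod 2} (hz : ∀ a, z (M.glue a) = z a) :
    ∑ a, before r a (M.glue a) * (M.index a + M.index (M.glue a)) * z a =
      ∑ a, (M.index a : ZMod 2) * z a := by
  have h1 : ∑ a, before r a (M.glue a) * M.index (M.glue a) * z a =
      ∑ a, before r (M.glue a) a * M.index a * z a := by
    rw [← Equiv.sum_comp (Function.Involutive.toPerm M.glue (glue_glue hd))
      fun a => before r (M.glue a) a * M.index a * z a]
    refine Finset.sum_congr rfl fun a _ => ?_
    change _ = before r (M.glue (M.glue a)) (M.glue a) * M.index (M.glue a) * z (M.glue a)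
    rw [glue_glue hd, hz]
  simp only [mul_add, add_mul, Finset.sum_add_distrib]
  rw [h1, ← Finset.sum_add_distrib]
  refine Finset.sum_congr rfl fun a _ => ?_
  rw [← add_mul, ← add_mul, before_add_swap fun h => (glue_spec hd a).1 (hr h).symm, one_mul]

theorem sum_eq_zero_of_glue [Fintype M.HalfEdge] (hd : 1 ≤ d) {z : M.HalfEdge → ZMod 2}
    (hz : ∀ a, z (M.glue a) = z a) : ∑ a, z a = 0 := by
  refine Finset.sum_involution (fun a _ => M.glue a) ?_ ?_ ?_ ?_
  · intro a _
    rw [hz]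
    exact CharTwo.add_self_eq_zero _
  · exact fun a _ _ => (glue_spec hd a).1
  · exact fun a _ => mem_univ _
  · exact fun a _ => glue_glue hd a

/-- The weight is a quadratic refinement of the pairing by the `∪_{d-2}` product. -/
theorem sigma_mul_sigma (hd : 2 ≤ d) (F : M.FramingChoice) (R : Finset V → Resolution d)
    {β β' : M.Cochain (d - 1)} (hβ : M.IsCocycle β) (hβ' : M.IsCocycle β') :
    M.sigma F R β * M.sigma F R β' =
      paritySign (M.integral (M.cup (d - 2) β β' d)) * M.sigma F R (β + β') := by
  have hd1 : 1 ≤ d := by omega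
  have := Fintype.ofFinite M.HalfEdge
  obtain ⟨r, hr⟩ := exists_lexRank (HalfEdge.simplex (M := M)) (fun h => legRank d (M.index h))
    fun a b hab h => eq_of_index_eq hab (legRank_injective (index_le a) (index_le b) h)
  obtain ⟨r', hr'⟩ := exists_lexRank M.facet
    (fun h : M.HalfEdge => ((Fintype.equivFin M.HalfEdge h : ℕ) : ℤ))
    fun a b _ h => by simpa [Fin.val_inj] using h
  let x : M.HalfEdge → ZMod 2 := fun a => M.ev β (M.facet a)
  let y : M.HalfEdge → ZMod 2 := fun a => M.ev β' (M.facet a)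
  have hx : ∀ a, x (M.glue a) = x a := fun a => congrArg (M.ev β) (glue_spec hd1 a).2
  have hy : ∀ a, y (M.glue a) = y a := fun a => congrArg (M.ev β') (glue_spec hd1 a).2
  have hxy : ∀ a, x (M.glue a) * y (M.glue a) = x a * y a := fun a => by rw [hx, hy]
  -- in the order by edges only the pairs of halves of an edge contribute
  have hedge : ∑ a, ∑ b, before r' a b * (x a * y b) =
      ∑ a, before r' a (M.glue a) * (x a * y a) := by
    refine Finset.sum_congr rfl fun a _ => ?_
    have h1 := sum_before_mul hr' (y := y) (fun a => by
      rw [sum_facet hd1, hy]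
      exact CharTwo.add_self_eq_zero _) a
    rw [sum_facet hd1, hy, show before r' a a = 0 from if_neg (lt_irrefl _), zero_mul,
      zero_add] at h1
    calc _ = x a * ∑ b, before r' a b * y b := by
          rw [Finset.mul_sum]
          exact Finset.sum_congr rfl fun b _ => by ring
      _ = _ := by rw [h1]; ring
  have hint := integral_cup hd hr β hβ'
  have hadd := inversions_add hr.injective hr'.injective x y
  have hglue := sum_before_glue hd1 hr'.injective (z := fun a => x a * y a) hxy
  have hzero := sum_eq_zero_of_glue hd1 (z := fun a => x a * y a) hxy
  have hev : ∀ a, M.ev (β + β') (M.facet a) = x a + y a := fun a => ev_add β β' _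
  rw [sigma_eq_paritySign hd F R hβ hr hr', sigma_eq_paritySign hd F R hβ' hr hr',
    sigma_eq_paritySign hd F R (hβ.add hβ') hr hr', mul_mul_mul_comm, ← Finset.prod_mul_distrib]
  simp only [hev, ite_mul_ite_eq (firstWeight_mul_self F r' _), Finset.prod_mul_distrib]
  have hexp : ∑ a, before r' a (M.glue a) * (1 + (M.index a + M.index (M.glue a))) * (x a * y a) =
      ∑ a, before r' a (M.glue a) * (x a * y a) +
        ∑ a, before r' a (M.glue a) * (M.index a + M.index (M.glue a)) * (x a * y a) := by
    rw [← Finset.sum_add_distrib]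
    exact Finset.sum_congr rfl fun a _ => by ring
  have hsum : (∑ a, before r' a (M.glue a) * (1 + (M.index a + M.index (M.glue a))) * (x a * y a)) +
      (∑ a, ∑ b, before r a b * before r' b a * (x a * x b) +
        ∑ a, ∑ b, before r a b * before r' b a * (y a * y b)) =
      M.integral (M.cup (d - 2) β β' d) +
        ∑ a, ∑ b, before r a b * before r' b a * ((x a + y a) * (x b + y b)) := by
    rw [hexp, hint, hadd, hedge, hglue]
    change _ = ∑ a, ∑ b, before r a b * (x a * y b) + ∑ a, (M.index a : ZMod 2) * (x a * y a) +
      ∑ a, x a * y a + _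
    rw [hzero]
    linear_combination -(CharTwo.add_self_eq_zero (∑ a, ∑ b, before r a b * (x a * y b)))
  have hsign := congrArg paritySign hsum
  rw [paritySign_add, paritySign_add, paritySign_add] at hsign
  rw [← paritySign_sum]
  linear_combination (∏ a, if x a + y a = 1 then firstWeight F r' a else 1) * hsign

end BranchedTriangulation

end LoopWeight

theorem mainTheorem3 {V : Type*} {d : ℕ} (hd : 2 ≤ d)
    (M : LoopWeight.BranchedTriangulation V d) (F : M.FramingChoice)
    (R : Finset V → LoopWeight.Resolution d) :
    (∀ α : M.Cochain (d - 1), M.IsCocycle α → ∀ h h' : M.Occ α,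
      M.loopOf R α h = M.loopOf R α h' →
        M.loopPhase F R α h.1 = M.loopPhase F R α h'.1) ∧
    ∀ β β' : M.Cochain (d - 1), M.IsCocycle β → M.IsCocycle β' →
      M.sigma F R β * M.sigma F R β' =
        (-1) ^ (M.integral (M.cup (d - 2) β β' d)).val * M.sigma F R (β + β') :=
  ⟨fun _ hα _ _ h => LoopWeight.BranchedTriangulation.loopPhase_eq_of_loopOf_eq hd F R hα h,
    fun _ _ hβ hβ' => LoopWeight.BranchedTriangulation.sigma_mul_sigma hd F R hβ hβ'⟩
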